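/- **Setting.** Let $X\subset\mathbb R^p$ be nonempty, compact and convex, contained in a cube of edge-length $D$, with diameter $D_X=\max_{x,x'\in X}\|x-x'\|$. Let $\Xi\subset\mathbb R^d$, let $\tilde\xi$ be a $\Xi$-valued random variable, and let $F:X\times\Xi\to\mathbb R$ be measurable in $\xi$ for each $x\in X$ and such that, for all $x,y\in X$ and $\xi\in\Xi$: $|F(x,\xi)-F(y,\xi)|\le L_F\|x-y\|^\gamma$, where $L_F\ge 0$ and $\gamma\in(0,1]$; $|F(x,\xi)|<M_F$, where $M_F\in(0,\infty)$; and $F(\cdot,\xi)$ is convex on $X$. Put $f(x)=\mathbb E[F(x,\tilde\xi)]$ and $X^*_\epsilon=\{x\in X: f(x)\le \min_X f+\epsilon\}$. Let $m,n\ge 1$, $N=mn$, and let $\tilde\xi_1,\dots,\tilde\xi_N$ be i.i.d. copies of $\tilde\xi$. The sample of replication $i\in\{1,\dots,m\}$ is $\xi^n_i=(\xi_{(i-1)n+1},\dots,\xi_{in})$. For a sample $s=(s_1,\dots,s_n)\in\Xi^n$ let $f_n(x;s)=\frac1n\sum_{k=1}^nF(x,s_k)$. A deterministic algorithm returns, for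 every sample $s\in\Xi^n$, a function $\hat f_n(x;s)=\max_{\ell\in L}\{\alpha_\ell+\langle\beta_\ell,x\rangle\}$ with finitely many pieces (the finite nonempty set $L$ and the coefficients depend on $s$) such that $\hat f_n(x;s)\le f_n(x;s)$ for all $x\in X$, and a point $\hat x_n(s)\in\arg\min_{x\in X}\hat f_n(x;s)$ such that $f_n(\hat x_n(s);s)-\hat f_n(\hat x_n(s);s)\le\epsilon_1$. Let $\epsilon_2\ge0$ and, for samples $s,s'\in\Xi^n$ and $x=\hat x_n(s')$, let $\upsilon_{n,\epsilon_2}(x;s)$ be an $\epsilon_2$-subgradient of $f_n(\cdot;s)$ at $x$, i.e. $f_n(y;s)\ge f_n(x;s)+\langle\upsilon_{n,\epsilon_2}(x;s),y-x\rangle-\epsilon_2$ for all $y\in X$. The functions $s\mapsto\hat f_n(x;s)$ (for each $x\in X$), $s\mapsto\hat x_n(s)$ and $(s,s')\mapsto\upsilon_{n,\epsilon_2}(\hat x_n(s');s)$ are assumed measurable. With $\hat x_n^j=\hat x_n(\xi_j^n)$ put $$\check f_n(x;\xi^n_i)=\max\Big\{\hat f_n(x;\xi^n_i),\ \max_{j=1,\dots,m}\big\{f_n(\hat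 x_n^j;\xi_i^n)+\langle\upsilon_{n,\epsilon_2}(\hat x_n^j;\xi_i^n),x-\hat x_n^j\rangle-\epsilon_2\big\}\Big\},$$ and, for $\rho>0$ and $\epsilon>0$, let $\check X_{N,\rho,\epsilon}(\xi^N)$ be the set of $\epsilon$-optimal solutions of the algorithm-augmented compromise problem $$\min_{x\in X}\ \frac1m\sum_{i=1}^m\check f_n(x;\xi_i^n)+\frac\rho2\Big\|x-\frac1m\sum_{j=1}^m\hat x_n^j\Big\|^2,$$ that is, the set of $x\in X$ at which this objective is at most its minimum over $X$ plus $\epsilon$. For sets $A,B$ let $\Delta(A,B)=\sup_{a\in A}\inf_{b\in B}\|a-b\|$. **Theorem 4.1.** Let $\lambda\in(0,\frac12)$ and $N_F=L_FD^\gamma p^{\gamma/2}+M_F\sqrt{2\log2}+\frac{M_Fp^{1/2}}{\sqrt{\gamma(1-2\lambda)e}}$. If $0<\epsilon\le\epsilon_1$, then: 1. $\Delta(\check X_{N,\rho,\epsilon}(\tilde\xi^N),X^*_\epsilon)$ is integrable and $$\mathbb E\big[\Delta(\check X_{N,\rho,\epsilon}(\tilde\xi^N),X^*_\epsilon)\big]\le\frac{D_XN_F}{\epsilon}\,\frac{8m-4}{mn^\lambda}+\frac{(\tau_1+\tau_2)D_X}{\epsilon}+2\sqrt{\epsilon/\rho},$$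 where $\tau_1=\epsilon_1-\epsilon$ and $\tau_2=\epsilon_1+\frac{m-1}m\epsilon_2-\epsilon$. 2. If moreover $\epsilon_1=\epsilon$, $\epsilon_2=0$, $\rho=n$, $D_X>0$ and $C=\frac{\epsilon^{3/2}}{D_X}+\frac{(4m-2)N_F}{m}$, then for every $t\ge0$ $$\Pr\Big\{\frac{\epsilon n^\lambda}{2D_X}\Delta(\check X_{N,\rho,\epsilon}(\tilde\xi^N),X^*_\epsilon)\ge C+t\Big\}\le m\exp\Big\{-\frac{m^2t^2}{2M_F^2(2m-1)^2}\Big\}.$$ -/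

import Mathlib

open MeasureTheory ProbabilityTheory

noncomputable section

namespace CompromiseSP

/-- `ℝ^p` with the Euclidean norm. -/
abbrev Vec (p : ℕ) : Type := EuclideanSpace ℝ (Fin p)

/-- The pessimistic distance `Δ(A, B) = sup_{a ∈ A} inf_{b ∈ B} ‖a - b‖`. -/
def pessimisticDist {p : ℕ} (A B : Set (Vec p)) : ℝ :=
  ⨆ a : A, ⨅ b : B, ‖(a : Vec p) - (b : Vec p)‖

/-- The `ε`-optimal solution set `{x ∈ X : g x ≤ min_X g + ε}` of `min_{x ∈ X} g x`. -/
def epsSolSet {p : ℕ} (X : Set (Vec p)) (g : Vec p → ℝ) (ε : ℝ) : Set (Vec p) :=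
  {x | x ∈ X ∧ g x ≤ sInf (g '' X) + ε}

/-- The set `X` is contained in an (axis-parallel) cube of edge-length `D`. -/
def InCube {p : ℕ} (X : Set (Vec p)) (D : ℝ) : Prop :=
  ∃ c : Vec p, ∀ x ∈ X, ∀ k : Fin p, c k ≤ x k ∧ x k ≤ c k + D

/-- The true objective `f(x) = E[F(x, ξ)]`. -/
def trueObj {p : ℕ} {S Ω : Type*} [MeasurableSpace Ω] (P : Measure Ω)
    (F : Vec p → S → ℝ) (ξ : Ω → S) (x : Vec p) : ℝ :=
  ∫ ω, F x (ξ ω) ∂P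

/-- The sample average objective `f_n(x; s) = (1/n) ∑_i F(x, s_i)` of a sample `s` of size `n`. -/
def saaObj {p n : ℕ} {S : Type*} (F : Vec p → S → ℝ) (s : Fin n → S) (x : Vec p) : ℝ :=
  (1 / (n : ℝ)) * ∑ i, F x (s i)

/-- The sample of the `i`-th replication: out of the samples numbered `0, …, m n - 1`, those with
numbers `n i + j`, `0 ≤ j < n`. -/
def replication {m n : ℕ} {S : Type*} (s : Fin (m * n) → S) (i : Fin m) : Fin n → S :=
  fun j => s (finProdFinEquiv (i, j))

/-- `v` is an `ε`-subgradient at `x` of the function `g` with domain `X`. -/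
def IsEpsSubgradient {p : ℕ} (X : Set (Vec p)) (g : Vec p → ℝ) (ε : ℝ) (x v : Vec p) : Prop :=
  ∀ y ∈ X, g x + inner ℝ v (y - x) - ε ≤ g y

/-- The output of a deterministic algorithm on a sample `s` of size `n`: finitely many (at least
one) affine pieces, given by pairs `(α, β)`, and an estimated decision. -/
structure CuttingPlaneOutput (p n : ℕ) (S : Type*) where
  pieces : (Fin n → S) → Finset (ℝ × Vec p)
  pieces_nonempty : ∀ s, (pieces s).Nonempty
  decision : (Fin n → S) → Vec p

/-- The piecewise linear function `max_ℓ (α_ℓ + ⟨β_ℓ, x⟩)` produced by the algorithm. -/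
def CuttingPlaneOutput.approx {p n : ℕ} {S : Type*} (A : CuttingPlaneOutput p n S)
    (s : Fin n → S) (x : Vec p) : ℝ :=
  (A.pieces s).sup' (A.pieces_nonempty s) (fun q => q.1 + inner ℝ q.2 x)

/-- On every sample, the piecewise linear function is a lower bound on `X` of the sample average
objective. -/
def CuttingPlaneOutput.OuterApproximation {p n : ℕ} {S : Type*} (A : CuttingPlaneOutput p n S)
    (X : Set (Vec p)) (F : Vec p → S → ℝ) : Prop :=
  ∀ s, ∀ x ∈ X, A.approx s x ≤ saaObj F s x

/-- On every sample, the estimated decision minimizes the piecewise linear function over `X`, and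
its gap to the sample average objective there is at most `ε₁`. -/
def CuttingPlaneOutput.Termination {p n : ℕ} {S : Type*} (A : CuttingPlaneOutput p n S)
    (X : Set (Vec p)) (F : Vec p → S → ℝ) (ε₁ : ℝ) : Prop :=
  ∀ s, A.decision s ∈ X ∧ IsMinOn (A.approx s) X (A.decision s) ∧
    saaObj F s (A.decision s) - A.approx s (A.decision s) ≤ ε₁

/-- The function of the `i`-th replication augmented by the cuts at the decisions of all
replications. Here `sub x s` stands for the chosen `ε₂`-subgradient of the sample average objective
of `s` at `x`. -/
def augmented {p m n : ℕ} {S : Type*} (F : Vec p → S → ℝ) (A : CuttingPlaneOutput p n S)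
    (sub : Vec p → (Fin n → S) → Vec p) (ε₂ : ℝ) (s : Fin (m * n) → S) (i : Fin m)
    (x : Vec p) : ℝ :=
  max (A.approx (replication s i) x)
    (⨆ j : Fin m,
      (saaObj F (replication s i) (A.decision (replication s j))
        + inner ℝ (sub (A.decision (replication s j)) (replication s i))
            (x - A.decision (replication s j))
        - ε₂))

/-- The objective of the algorithm-augmented compromise decision problem. -/
def compromiseObj {p m n : ℕ} {S : Type*} (F : Vec p → S → ℝ) (A : CuttingPlaneOutput p n S)
    (sub : Vec p → (Fin n → S) → Vec p) (ε₂ ρ : ℝ) (s : Fin (m * n) → S) (x : Vec p) : ℝ :=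
  (1 / (m : ℝ)) * ∑ i : Fin m, augmented F A sub ε₂ s i x
    + ρ / 2 * ‖x - (1 / (m : ℝ)) • ∑ i : Fin m, A.decision (replication s i)‖ ^ 2

/-- The `ε`-optimal solution set of the algorithm-augmented compromise decision problem. -/
def compromiseSolSet {p m n : ℕ} {S : Type*} (X : Set (Vec p)) (F : Vec p → S → ℝ)
    (A : CuttingPlaneOutput p n S) (sub : Vec p → (Fin n → S) → Vec p) (ε₂ ρ ε : ℝ)
    (s : Fin (m * n) → S) : Set (Vec p) :=
  epsSolSet X (compromiseObj F A sub ε₂ ρ s) ε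

/-- The pessimistic distance from the `ε`-optimal solution set of the algorithm-augmented
compromise decision problem, built from the samples `ξ k ω`, to that of the true problem. -/
def compromiseDist {p m n : ℕ} {S Ω : Type*} [MeasurableSpace Ω] (P : Measure Ω)
    (X : Set (Vec p)) (F : Vec p → S → ℝ) (ξt : Ω → S) (ξ : Fin (m * n) → Ω → S)
    (A : CuttingPlaneOutput p n S) (sub : Vec p → (Fin n → S) → Vec p) (ε₂ ρ ε : ℝ)
    (ω : Ω) : ℝ :=
  pessimisticDist (compromiseSolSet X F A sub ε₂ ρ ε (fun k => ξ k ω))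
    (epsSolSet X (trueObj P F ξt) ε)

/-- The constant
`N_F = L D^γ p^(γ/2) + M √(2 log 2) + M p^(1/2) / √(γ (1 - 2 lam) e)`. -/
def constNF (p : ℕ) (L D γ M lam : ℝ) : ℝ :=
  L * D ^ γ * (p : ℝ) ^ (γ / 2) + M * √(2 * Real.log 2)
    + M * √(p : ℝ) / √(γ * (1 - 2 * lam) * Real.exp 1)

end CompromiseSP

end

open MeasureTheory ProbabilityTheory

noncomputable section

/-! All randomness enters through `δ i`, the uniform deviation over `X` between the sample average
of replication `i` and the true objective `f`. A deterministic estimate bounds the distance by an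
affine function of `∑ δ i`; empirical process bounds then control the mean and the tail of each `δ
i`.

Deterministic part (`pessimisticDist_epsSolSet_le`). Let `x̄` be the average decision. Each decision
is `ε₁`-optimal for its own sample average, so by convexity `x̄` is `ε + η₁`-optimal for `f`, with
`η₁ = ε₁ - ε + (2/m) ∑ δ i`. Moving it towards a minimizer of `f` reaches the `ε`-optimal set within
`D_X η₁ / ε`. For an `ε`-optimal compromise point `a`, comparing its objective value with that at
`x̄` bounds the quadratic penalty by `2ε + η₂`, with `η₂ = ε₁ - ε + (2(m-1)/m²) ∑ δ i`. Hence `‖a -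
x̄‖ ≤ D_X η₂ / ε + 2√(ε/ρ)`, and the triangle inequality adds the two distances. The augmented
functions enter only through two bounds: each lies below its sample average on `X`, and above the
sample average at its own decision minus `ε₁`.

Probabilistic part. A net of `X`, Hölder continuity and the maximal inequality for sub-Gaussian
variables give mean deviation at most `2 N_F / n^λ` (`integral_uniformDev_le`). Changing one sample
moves the deviation by at most `2M/n`, so McDiarmid's inequality gives its tail
(`measure_uniformDev_ge_le`). Linearity of expectation yields the first claim, a union bound over
the replications the second. -/

namespace CompromiseSP

/-! ### Exponential moments and bounded differences -/

/-- Hoeffding's lemma for a function of oscillation at most `c`. -/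
theorem integral_exp_mul_le_of_oscillation {S : Type*} [MeasurableSpace S] (ν : Measure S)
    [IsProbabilityMeasure ν] {h : S → ℝ} (hh : Measurable h) {c : ℝ}
    (hc : ∀ z z', h z - h z' ≤ c) (t : ℝ) :
    ∫ z, Real.exp (t * h z) ∂ν ≤ Real.exp (t * ∫ z, h z ∂ν + c ^ 2 * t ^ 2 / 8) := by
  obtain ⟨z₀⟩ : Nonempty S := nonempty_of_isProbabilityMeasure ν
  have hbdd : BddBelow (Set.range h) := ⟨h z₀ - c, by rintro _ ⟨z, rfl⟩; linarith [hc z₀ z]⟩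
  have hmem : ∀ᵐ z ∂ν, h z ∈ Set.Icc (iInf h) (iInf h + c) := by
    refine Filter.Eventually.of_forall fun z => ⟨ciInf_le hbdd z, ?_⟩
    have : h z - c ≤ iInf h := by
      have : Nonempty S := ⟨z₀⟩
      exact le_ciInf fun z' => by linarith [hc z z']
    linarith
  have hsg := (hasSubgaussianMGF_of_mem_Icc hh.aemeasurable hmem).mgf_le t
  have hrw : mgf (fun z => h z - ∫ z, h z ∂ν) ν t
      = (∫ z, Real.exp (t * h z) ∂ν) * Real.exp (-(t * ∫ z, h z ∂ν)) := by
    rw [mgf, ← integral_mul_const]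
    congr 1 with z
    rw [← Real.exp_add]; ring_nf
  rw [hrw] at hsg
  have hsg' := mul_le_mul_of_nonneg_right hsg (Real.exp_nonneg (t * ∫ z, h z ∂ν))
  rw [mul_assoc, ← Real.exp_add, neg_add_cancel, Real.exp_zero, mul_one, ← Real.exp_add] at hsg'
  refine hsg'.trans (Real.exp_le_exp.2 (le_of_eq ?_))
  push_cast
  simp only [add_sub_cancel_left, Real.norm_eq_abs]
  rw [div_pow, sq_abs]; ring

theorem integrable_of_measurable_of_abs_le {S : Type*} [MeasurableSpace S] {ν : Measure S}
    [IsFiniteMeasure ν] {g : S → ℝ} (hg : Measurable g) {C : ℝ} (hC : ∀ s, |g s| ≤ C) :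
    Integrable g ν :=
  Integrable.of_bound hg.aestronglyMeasurable C (Filter.Eventually.of_forall hC)

theorem integrable_exp_mul_of_abs_le {S : Type*} [MeasurableSpace S] {ν : Measure S}
    [IsFiniteMeasure ν] {g : S → ℝ} (hg : Measurable g) {C : ℝ} (hC : ∀ s, |g s| ≤ C) (t : ℝ) :
    Integrable (fun s => Real.exp (t * g s)) ν := by
  refine integrable_of_measurable_of_abs_le (by fun_prop) (C := Real.exp (|t| * C)) fun s => ?_
  rw [abs_of_pos (Real.exp_pos _)]
  refine Real.exp_le_exp.2 ((le_abs_self _).trans ?_)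
  rw [abs_mul]
  exact mul_le_mul_of_nonneg_left (hC s) (abs_nonneg t)

/-- McDiarmid's bounded difference inequality, in exponential moment form. -/
theorem integral_exp_mul_le_of_boundedDifferences {S : Type*} [MeasurableSpace S] (ν : Measure S)
    [IsProbabilityMeasure ν] {C c : ℝ} (t : ℝ) : ∀ (n : ℕ) {g : (Fin n → S) → ℝ},
    Measurable g → (∀ s, |g s| ≤ C) →
    (∀ s i z, |g (Function.update s i z) - g s| ≤ c) →
    ∫ s, Real.exp (t * g s) ∂(Measure.pi fun _ => ν)
      ≤ Real.exp (t * ∫ s, g s ∂(Measure.pi fun _ => ν) + n * c ^ 2 * t ^ 2 / 8) := by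
  intro n
  induction n with
  | zero =>
    intro g _ _ _
    rw [Measure.pi_of_empty]
    simp
  | succ n ih =>
    intro g hg hC hc
    set e := (MeasurableEquiv.piFinSuccAbove (fun _ : Fin (n + 1) => S) 0).symm with he
    have hmp : MeasurePreserving e (ν.prod (Measure.pi fun _ => ν)) (Measure.pi fun _ => ν) :=
      (measurePreserving_piFinSuccAbove (fun _ : Fin (n + 1) => ν) 0).symm
    have he' : ∀ z s, e (z, s) = Fin.cons z s := fun z s => by
      simp [he, MeasurableEquiv.piFinSuccAbove, Fin.insertNthEquiv]
    have hint : ∀ φ : (Fin (n + 1) → S) → ℝ, Integrable φ (Measure.pi fun _ => ν) →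
        ∫ s, φ s ∂(Measure.pi fun _ => ν)
          = ∫ z, ∫ s, φ (e (z, s)) ∂(Measure.pi fun _ => ν) ∂ν := by
      intro φ hφ
      rw [← hmp.integral_comp e.measurableEmbedding φ]
      exact integral_prod _ ((hmp.integrable_comp_emb e.measurableEmbedding).2 hφ)
    have hge : Measurable fun q => g (e q) := hg.comp e.measurable
    -- Average out all coordinates but the first. The slices of `g` fall under the induction
    -- hypothesis, while `h` has oscillation at most `c` and falls under Hoeffding's lemma; each
    -- step contributes one `c ^ 2 * t ^ 2 / 8`.
    set h : S → ℝ := fun z => ∫ s, g (e (z, s)) ∂(Measure.pi fun _ => ν) with hh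
    have hhm : Measurable h := by
      exact (hge.stronglyMeasurable.integral_prod_right').measurable
    have hgz : ∀ z, Integrable (fun s => g (e (z, s))) (Measure.pi fun _ : Fin n => ν) := fun z =>
      integrable_of_measurable_of_abs_le (hge.comp measurable_prodMk_left) fun s => hC _
    have hhc : ∀ z z', h z - h z' ≤ c := by
      intro z z'
      rw [hh, ← integral_sub (hgz z) (hgz z')]
      refine (integral_mono ((hgz z).sub (hgz z')) (integrable_const c) fun s => ?_).trans
        (by simp)
      have := hc (e (z', s)) 0 z
      rw [he', Fin.update_cons_zero, ← he', ← he'] at this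
      exact (le_abs_self _).trans this
    have hstep : ∀ z, ∫ s, Real.exp (t * g (e (z, s))) ∂(Measure.pi fun _ => ν)
        ≤ Real.exp (t * h z) * Real.exp (n * c ^ 2 * t ^ 2 / 8) := by
      intro z
      rw [← Real.exp_add]
      refine ih (hge.comp measurable_prodMk_left) (fun s => hC _) fun s i z' => ?_
      have := hc (e (z, s)) i.succ z'
      rw [he', ← Fin.cons_update, ← he', ← he'] at this
      exact this
    have hhC : ∀ z, |h z| ≤ C := by
      intro z
      refine (abs_integral_le_integral_abs).trans ?_
      refine (integral_mono (hgz z).abs (integrable_const C) fun s => hC _).trans (by simp)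
    rw [hint g (integrable_of_measurable_of_abs_le hg hC),
      hint _ (integrable_exp_mul_of_abs_le hg hC t)]
    have hexpm : Measurable fun z =>
        ∫ s, Real.exp (t * g (e (z, s))) ∂(Measure.pi fun _ : Fin n => ν) :=
      (StronglyMeasurable.integral_prod_right'
        (f := fun q => Real.exp (t * g (e q)))
        (Measurable.stronglyMeasurable (by fun_prop))).measurable
    have hi : Integrable (fun z => Real.exp (t * h z) * Real.exp (n * c ^ 2 * t ^ 2 / 8)) ν :=
      (integrable_exp_mul_of_abs_le hhm hhC t).mul_const _
    calc ∫ z, ∫ s, Real.exp (t * g (e (z, s))) ∂(Measure.pi fun _ => ν) ∂ν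
        ≤ ∫ z, Real.exp (t * h z) * Real.exp (n * c ^ 2 * t ^ 2 / 8) ∂ν := by
          refine integral_mono (hi.mono' hexpm.aestronglyMeasurable
            (Filter.Eventually.of_forall fun z => ?_)) hi hstep
          rw [Real.norm_of_nonneg (integral_nonneg fun s => (Real.exp_pos _).le)]
          exact hstep z
      _ = (∫ z, Real.exp (t * h z) ∂ν) * Real.exp (n * c ^ 2 * t ^ 2 / 8) :=
          integral_mul_const _ _
      _ ≤ Real.exp (t * ∫ z, h z ∂ν + c ^ 2 * t ^ 2 / 8) * Real.exp (n * c ^ 2 * t ^ 2 / 8) := by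
          gcongr
          exact integral_exp_mul_le_of_oscillation ν hhm hhc t
      _ = _ := by
          rw [← Real.exp_add]; push_cast; simp only [hh]; ring_nf

/-- A function with bounded differences is sub-Gaussian under a product measure. -/
theorem hasSubgaussianMGF_of_boundedDifferences {S : Type*} [MeasurableSpace S] (ν : Measure S)
    [IsProbabilityMeasure ν] {C c : ℝ} {n : ℕ} {g : (Fin n → S) → ℝ}
    (hg : Measurable g) (hC : ∀ s, |g s| ≤ C)
    (hc : ∀ s i z, |g (Function.update s i z) - g s| ≤ c) :
    HasSubgaussianMGF (fun s => g s - ∫ s, g s ∂(Measure.pi fun _ => ν))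
      (Real.toNNReal (n * c ^ 2 / 4)) (Measure.pi fun _ : Fin n => ν) := by
  set E := ∫ s, g s ∂(Measure.pi fun _ : Fin n => ν)
  have hv : (0 : ℝ) ≤ n * c ^ 2 / 4 := by positivity
  constructor
  · intro t
    have hb : ∀ s, |g s - E| ≤ C + |E| := fun s => (abs_sub _ _).trans (by linarith [hC s])
    exact integrable_exp_mul_of_abs_le (hg.sub_const E) hb t
  · intro t
    have := integral_exp_mul_le_of_boundedDifferences ν t n hg hC hc
    have hrw : mgf (fun s => g s - E) (Measure.pi fun _ : Fin n => ν) t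
        = (∫ s, Real.exp (t * g s) ∂(Measure.pi fun _ : Fin n => ν)) * Real.exp (-(t * E)) := by
      rw [mgf, ← integral_mul_const]
      congr 1 with s
      rw [← Real.exp_add]; ring_nf
    rw [hrw]
    refine (mul_le_mul_of_nonneg_right this (Real.exp_nonneg _)).trans ?_
    rw [← Real.exp_add]
    refine Real.exp_le_exp.2 (le_of_eq ?_)
    rw [Real.coe_toNNReal _ hv]
    ring

/-- McDiarmid's bounded difference inequality. -/
theorem measure_ge_le_of_boundedDifferences {S : Type*} [MeasurableSpace S] (ν : Measure S)
    [IsProbabilityMeasure ν] {C c : ℝ} {n : ℕ} {g : (Fin n → S) → ℝ}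
    (hg : Measurable g) (hC : ∀ s, |g s| ≤ C)
    (hc : ∀ s i z, |g (Function.update s i z) - g s| ≤ c) {r : ℝ} (hr : 0 ≤ r) :
    (Measure.pi fun _ => ν).real {s | r ≤ g s - ∫ s, g s ∂(Measure.pi fun _ => ν)}
      ≤ Real.exp (-(2 * r ^ 2 / (n * c ^ 2))) := by
  refine ((hasSubgaussianMGF_of_boundedDifferences ν hg hC hc).measure_ge_le hr).trans
    (Real.exp_le_exp.2 (le_of_eq ?_))
  rw [Real.coe_toNNReal _ (by positivity), neg_div,
    show 2 * ((n : ℝ) * c ^ 2 / 4) = n * c ^ 2 / 2 by ring, div_div_eq_mul_div]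
  ring

/-! ### Nets of a cube, the maximal inequality and the mesh -/

theorem exists_cell_map {D : ℝ} (hD : 0 ≤ D) {K : ℕ} (hK : 0 < K) :
    ∃ φ : ℝ → Fin K, ∀ a b, 0 ≤ a → a ≤ D → 0 ≤ b → b ≤ D → φ a = φ b → |a - b| ≤ D / K := by
  rcases hD.eq_or_lt with rfl | hD
  · refine ⟨fun _ => ⟨0, hK⟩, fun a b h1 h2 h3 h4 _ => ?_⟩
    rw [le_antisymm h2 h1, le_antisymm h4 h3]; simp
  have hK' : (0 : ℝ) < K := by exact_mod_cast hK
  have hDK : 0 < D / K := by positivity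
  -- The endpoint `a = D` has floor `K`; the minimum with `K - 1` puts it in the last cell.
  refine ⟨fun a => ⟨min ⌊a / (D / K)⌋₊ (K - 1), by omega⟩, fun a b ha haD hb hbD hab => ?_⟩
  have hcell : ∀ a, 0 ≤ a → a ≤ D →
      (min ⌊a / (D / K)⌋₊ (K - 1) : ℕ) * (D / K) ≤ a ∧
        a ≤ ((min ⌊a / (D / K)⌋₊ (K - 1) : ℕ) + 1) * (D / K) := by
    intro a ha haD
    have h1 : ((min ⌊a / (D / K)⌋₊ (K - 1) : ℕ) : ℝ) ≤ a / (D / K) :=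
      le_trans (by exact_mod_cast min_le_left _ _) (Nat.floor_le (by positivity))
    refine ⟨(le_div_iff₀ hDK).1 h1, ?_⟩
    rcases min_cases ⌊a / (D / K)⌋₊ (K - 1) with ⟨h, _⟩ | ⟨h, _⟩ <;> rw [h]
    · exact (div_le_iff₀ hDK).1 (Nat.lt_floor_add_one _).le
    · rw [Nat.cast_sub hK]
      push_cast
      rw [sub_add_cancel, mul_div_cancel₀ _ hK'.ne']
      exact haD
  have hab' : min ⌊a / (D / K)⌋₊ (K - 1) = min ⌊b / (D / K)⌋₊ (K - 1) := congrArg Fin.val hab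
  have h1 := hcell a ha haD
  have h2 := hcell b hb hbD
  rw [← hab'] at h2
  rw [abs_le]
  constructor <;> nlinarith [h1.1, h1.2, h2.1, h2.2]

/-- A subset of a cube of edge-length `D` has a `√p D / K`-net with at most `K ^ p` points. -/
theorem InCube.exists_net {p : ℕ} {X : Set (Vec p)} {D : ℝ} (hX : InCube X D) (hD : 0 ≤ D)
    {K : ℕ} (hK : 0 < K) :
    ∃ T : Finset (Vec p), (∀ y ∈ T, y ∈ X) ∧ T.card ≤ K ^ p ∧
      ∀ x ∈ X, ∃ y ∈ T, ‖x - y‖ ≤ √p * (D / K) := by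
  classical
  obtain ⟨c, hc⟩ := hX
  obtain ⟨φ, hφ⟩ := exists_cell_map hD hK
  set idx : Vec p → (Fin p → Fin K) := fun x k => φ (x k - c k) with hidx
  -- One representative in `X` for each cell that meets `X`, so that the hypotheses on `F` apply on
  -- the net. The value `0` for the other cells is discarded by the filter below.
  have hrep : ∀ v : Fin p → Fin K, ∃ y : Vec p, (∃ x ∈ X, idx x = v) → y ∈ X ∧ idx y = v := by
    intro v
    by_cases h : ∃ x ∈ X, idx x = v
    · obtain ⟨x, hx⟩ := h
      exact ⟨x, fun _ => hx⟩
    · exact ⟨0, fun h' => absurd h' h⟩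
  choose rep hrep using hrep
  refine ⟨(Finset.univ.filter fun v => ∃ x ∈ X, idx x = v).image rep, ?_, ?_, ?_⟩
  · intro y hy
    obtain ⟨v, hv, rfl⟩ := Finset.mem_image.1 hy
    exact (hrep v (Finset.mem_filter.1 hv).2).1
  · refine Finset.card_image_le.trans ((Finset.card_filter_le _ _).trans ?_)
    simp
  · intro x hx
    have hx' : ∃ x' ∈ X, idx x' = idx x := ⟨x, hx, rfl⟩
    refine ⟨rep (idx x), Finset.mem_image_of_mem _
      (Finset.mem_filter.2 ⟨Finset.mem_univ _, hx'⟩), ?_⟩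
    obtain ⟨hy, hyi⟩ := hrep _ hx'
    set y := rep (idx x)
    have hk : ∀ k, ‖(x - y) k‖ ^ 2 ≤ (D / K) ^ 2 := by
      intro k
      have hb : |(x k - c k) - (y k - c k)| ≤ D / K := by
        refine hφ _ _ ?_ ?_ ?_ ?_ (congrFun hyi k).symm
        · linarith [(hc x hx k).1]
        · linarith [(hc x hx k).2]
        · linarith [(hc y hy k).1]
        · linarith [(hc y hy k).2]
      rw [sub_sub_sub_cancel_right] at hb
      rw [Real.norm_eq_abs, PiLp.sub_apply]
      gcongr
    rw [EuclideanSpace.norm_eq]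
    refine (Real.sqrt_le_sqrt (Finset.sum_le_sum fun k _ => hk k)).trans (le_of_eq ?_)
    rw [Finset.sum_const, Finset.card_univ, Fintype.card_fin, nsmul_eq_mul,
      Real.sqrt_mul (by positivity), Real.sqrt_sq (by positivity)]

/-- The maximal inequality for finitely many sub-Gaussian random variables. -/
theorem integral_le_of_hasSubgaussianMGF {Ω ι : Type*} [MeasurableSpace Ω] {μ : Measure Ω}
    [IsProbabilityMeasure μ] {T : Finset ι} {N : ℕ} (hN : 0 < N) (hT : T.card ≤ N)
    {Y : ι → Ω → ℝ} {v : NNReal} (hv : 0 < v) (hY : ∀ i ∈ T, HasSubgaussianMGF (Y i) v μ)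
    {W : Ω → ℝ} (hW : Integrable W μ) {B : ℝ} (hWY : ∀ ω, ∃ i ∈ T, W ω ≤ B + |Y i ω|) :
    ∫ ω, W ω ∂μ ≤ B + √(2 * v * Real.log (2 * N)) := by
  have hv' : (0 : ℝ) < v := hv
  have hN1 : (1 : ℝ) ≤ N := by exact_mod_cast hN
  have hlog : 0 < Real.log (2 * N) := Real.log_pos (by linarith)
  set l := Real.log (2 * N)
  -- This minimizes `l / r + v * r / 2`, the bound obtained from the exponential moments at `r`.
  set r := √(2 * l / v) with hr
  have hrpos : 0 < r := Real.sqrt_pos.2 (by positivity)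
  have hr2 : r ^ 2 = 2 * l / v := Real.sq_sqrt (by positivity)
  set a := 2 * (N : ℝ) * Real.exp (v * r ^ 2 / 2) with ha
  have hapos : 0 < a := by positivity
  have hloga : Real.log a = l + v * r ^ 2 / 2 := by
    rw [ha, Real.log_mul (by positivity) (Real.exp_pos _).ne', Real.log_exp]
  have hi1 : ∀ i ∈ T, Integrable (fun ω => Real.exp (r * Y i ω)) μ :=
    fun i hi => (hY i hi).integrable_exp_mul r
  have hi2 : ∀ i ∈ T, Integrable (fun ω => Real.exp (-r * Y i ω)) μ :=
    fun i hi => (hY i hi).integrable_exp_mul (-r)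
  have hi12 : ∀ i ∈ T, Integrable (fun ω => Real.exp (r * Y i ω) + Real.exp (-r * Y i ω)) μ :=
    fun i hi => (hi1 i hi).add (hi2 i hi)
  have hisum : Integrable
      (fun ω => ∑ i ∈ T, (Real.exp (r * Y i ω) + Real.exp (-r * Y i ω))) μ :=
    integrable_finsetSum _ hi12
  have hpt : ∀ ω, r * (W ω - B) ≤ Real.log a - 1
      + (∑ i ∈ T, (Real.exp (r * Y i ω) + Real.exp (-r * Y i ω))) / a := by
    intro ω
    obtain ⟨i, hi, hWi⟩ := hWY ω
    have h1 : r * (W ω - B) ≤ r * |Y i ω| := by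
      apply mul_le_mul_of_nonneg_left _ hrpos.le; linarith
    have h2 : Real.exp (r * |Y i ω|) ≤ Real.exp (r * Y i ω) + Real.exp (-r * Y i ω) := by
      rcases abs_cases (Y i ω) with ⟨h, _⟩ | ⟨h, _⟩ <;> rw [h]
      · linarith [Real.exp_pos (-r * Y i ω)]
      · rw [mul_neg, ← neg_mul]; linarith [Real.exp_pos (r * Y i ω)]
    have h3 : Real.exp (r * Y i ω) + Real.exp (-r * Y i ω)
        ≤ ∑ i ∈ T, (Real.exp (r * Y i ω) + Real.exp (-r * Y i ω)) :=
      Finset.single_le_sum (f := fun i => Real.exp (r * Y i ω) + Real.exp (-r * Y i ω))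
        (fun i _ => by positivity) hi
    -- The tangent to the logarithm at `a`, used pointwise in place of Jensen's inequality; `a`
    -- bounds the mean of the sum of exponentials, so integrating loses nothing.
    have h4 := Real.add_one_le_exp (r * |Y i ω| - Real.log a)
    rw [Real.exp_sub, Real.exp_log hapos] at h4
    have h5 := div_le_div_of_nonneg_right (h2.trans h3) hapos.le
    linarith
  have hmono := integral_mono (((hW.sub (integrable_const B)).const_mul r))
    ((integrable_const (Real.log a - 1)).add (hisum.div_const a)) hpt
  have hlhs : ∫ ω, r * (W ω - B) ∂μ = r * (∫ ω, W ω ∂μ - B) := by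
    rw [integral_const_mul, integral_sub hW (integrable_const B)]; simp
  have hsum : ∫ ω, ∑ i ∈ T, (Real.exp (r * Y i ω) + Real.exp (-r * Y i ω)) ∂μ ≤ a := by
    rw [integral_finsetSum _ hi12]
    have hterm : ∀ i ∈ T, ∫ ω, (Real.exp (r * Y i ω) + Real.exp (-r * Y i ω)) ∂μ
        ≤ 2 * Real.exp (v * r ^ 2 / 2) := by
      intro i hi
      rw [integral_add (hi1 i hi) (hi2 i hi)]
      have e1 := (hY i hi).mgf_le r
      have e2 := (hY i hi).mgf_le (-r)
      rw [neg_sq] at e2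
      rw [mgf] at e1 e2
      linarith
    refine (Finset.sum_le_sum hterm).trans ?_
    rw [Finset.sum_const, nsmul_eq_mul, ha]
    have : (T.card : ℝ) ≤ N := by exact_mod_cast hT
    nlinarith [Real.exp_pos (v * r ^ 2 / 2)]
  have hrhs : ∫ ω, (Real.log a - 1
      + (∑ i ∈ T, (Real.exp (r * Y i ω) + Real.exp (-r * Y i ω))) / a) ∂μ ≤ Real.log a := by
    rw [integral_add (integrable_const _) (hisum.div_const a), integral_div]
    have : (∫ ω, ∑ i ∈ T, (Real.exp (r * Y i ω) + Real.exp (-r * Y i ω)) ∂μ) / a ≤ 1 :=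
      (div_le_one hapos).2 hsum
    simp only [integral_const, probReal_univ, one_smul]
    linarith
  have hfin : r * (∫ ω, W ω ∂μ - B) ≤ 2 * l := by
    have : (v : ℝ) * r ^ 2 / 2 = l := by rw [hr2]; field_simp
    rw [← hlhs]
    refine (hmono.trans hrhs).trans ?_
    rw [hloga, this]; linarith
  have hrs : r * √(2 * v * l) = 2 * l := by
    rw [hr, ← Real.sqrt_mul (by positivity),
      show 2 * l / v * (2 * v * l) = (2 * l) ^ 2 by field_simp]
    exact Real.sqrt_sq (by positivity)
  rw [← hrs] at hfin
  linarith [le_of_mul_le_mul_left hfin hrpos]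

/-- This is `log u ≤ u - 1` at `u = x ^ a / e`. With `x = n` and `a = 1 - 2 * lam` it produces the
factor `(1 - 2 * lam) * e` in `N_F`. -/
theorem log_le_rpow_div {x a : ℝ} (hx : 0 < x) (ha : 0 < a) :
    Real.log x ≤ x ^ a / (a * Real.exp 1) := by
  have h := Real.log_le_sub_one_of_pos (x := x ^ a / Real.exp 1) (by positivity)
  rw [Real.log_div (by positivity) (Real.exp_pos _).ne', Real.log_rpow hx, Real.log_exp] at h
  rw [mul_comm a, ← div_div, le_div_iff₀ ha]
  linarith

/-- The choice of the mesh of the net. -/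
theorem exists_mesh_le (p : ℕ) {L D γ M lam : ℝ} (hL : 0 ≤ L) (hD : 0 ≤ D) (hγ0 : 0 < γ)
    (hγ1 : γ ≤ 1) (hM : 0 < M) (hlam0 : 0 < lam) (hlam1 : lam < 1 / 2) {n : ℕ} (hn : 0 < n) :
    ∃ K : ℕ, 0 < K ∧ 2 * (L * (√p * (D / K)) ^ γ)
        + √(2 * (M ^ 2 / n) * Real.log (2 * (K ^ p : ℕ)))
      ≤ 2 * constNF p L D γ M lam / (n : ℝ) ^ lam := by
  have hn1 : (1 : ℝ) ≤ n := by exact_mod_cast hn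
  have hn0 : (0 : ℝ) < n := by linarith
  -- With about `n ^ (1 / γ)` cells per axis, the Hölder error gains a factor `1 / n`, more than the
  -- required `1 / n ^ lam`.
  set y : ℝ := (n : ℝ) ^ (1 / γ) with hy
  have hy1 : 1 ≤ y := Real.one_le_rpow hn1 (by positivity)
  have hyn : (n : ℝ) ≤ y := by
    calc (n : ℝ) = (n : ℝ) ^ (1 : ℝ) := (Real.rpow_one _).symm
      _ ≤ y := Real.rpow_le_rpow_of_exponent_le hn1 (by rw [le_div_iff₀ hγ0]; linarith)
  set K := ⌈y⌉₊ with hK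
  have hK0 : 0 < K := Nat.ceil_pos.2 (by linarith)
  have hK0' : (0 : ℝ) < K := by exact_mod_cast hK0
  have hK1' : (1 : ℝ) ≤ K := by exact_mod_cast hK0
  have hyK : y ≤ K := Nat.le_ceil y
  have hlogy : Real.log y = Real.log n / γ := by
    rw [hy, Real.log_rpow hn0]; ring
  -- The factor `2` absorbs the rounding: `K ≤ y + 1 ≤ y ^ 2` when `n ≥ 2`, and `K = y = 1` when `n
  -- = 1`.
  have hlogK : Real.log K ≤ 2 * (Real.log n / γ) := by
    rw [← hlogy, ← Real.log_rpow (by linarith)]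
    refine Real.log_le_log hK0' ?_
    rw [Real.rpow_two]
    rcases Nat.lt_or_ge 1 n with h | h
    · have : (2 : ℝ) ≤ n := by exact_mod_cast h
      have := (Nat.ceil_lt_add_one (show 0 ≤ y by linarith)).le
      rw [← hK] at this
      nlinarith
    · have hn' : n = 1 := by omega
      have : y = 1 := by rw [hy, hn']; simp
      rw [hK, this]; simp
  have hlogn : Real.log n ≤ (n : ℝ) ^ (1 - 2 * lam) / ((1 - 2 * lam) * Real.exp 1) :=
    log_le_rpow_div hn0 (by linarith)
  set a := 1 - 2 * lam with ha
  have ha0 : 0 < a := by linarith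
  set q := (n : ℝ) ^ lam with hq
  have hq0 : 0 < q := by positivity
  have hqn : q ≤ n := by
    calc q ≤ (n : ℝ) ^ (1 : ℝ) := Real.rpow_le_rpow_of_exponent_le hn1 (by linarith)
      _ = n := Real.rpow_one _
  have hq2 : q ^ 2 * (n : ℝ) ^ a = n := by
    rw [hq, ← Real.rpow_natCast, ← Real.rpow_mul hn0.le, ← Real.rpow_add hn0, ha]
    norm_num
    rw [show lam * 2 + (1 - 2 * lam) = 1 by ring, Real.rpow_one]
  have hna1 : 1 ≤ (n : ℝ) ^ a := Real.one_le_rpow hn1 ha0.le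
  refine ⟨K, hK0, ?_⟩
  have hfirst : L * (√p * (D / K)) ^ γ ≤ L * D ^ γ * (p : ℝ) ^ (γ / 2) / q := by
    have hKγ : q ≤ (K : ℝ) ^ γ := by
      refine hqn.trans ?_
      calc (n : ℝ) = y ^ γ := by rw [hy, ← Real.rpow_mul hn0.le]; field_simp; simp
        _ ≤ (K : ℝ) ^ γ := Real.rpow_le_rpow (by linarith) hyK hγ0.le
    rw [Real.mul_rpow (by positivity) (by positivity), Real.div_rpow hD hK0'.le,
      Real.sqrt_eq_rpow, ← Real.rpow_mul (by positivity), show 1 / 2 * γ = γ / 2 by ring,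
      mul_assoc L, mul_div_assoc L, mul_comm (D ^ γ), mul_div_assoc]
    have := Real.rpow_nonneg hD γ
    gcongr
  -- The square root splits by `u ^ 2 + 4 * w ^ 2 ≤ (u + 2 * w) ^ 2`; the powers of `n` cancel
  -- because `q ^ 2 * n ^ a = n`.
  have hsecond : √(2 * (M ^ 2 / n) * Real.log (2 * (K ^ p : ℕ)))
      ≤ (M * √(2 * Real.log 2) + 2 * (M * √(p : ℝ) / √(γ * a * Real.exp 1))) / q := by
    have hrhs : 0 ≤ (M * √(2 * Real.log 2) + 2 * (M * √(p : ℝ) / √(γ * a * Real.exp 1))) / q := by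
      positivity
    rw [Nat.cast_pow, Real.log_mul two_ne_zero (by positivity), Real.log_pow]
    refine Real.sqrt_le_iff.2 ⟨hrhs, ?_⟩
    have hl2 : 0 < Real.log 2 := Real.log_pos one_lt_two
    set u := M * √(2 * Real.log 2) with hu
    set w := M * √(p : ℝ) / √(γ * a * Real.exp 1) with hw
    have hu2 : u ^ 2 = M ^ 2 * (2 * Real.log 2) := by
      rw [hu, mul_pow, Real.sq_sqrt (by positivity)]
    have hw2 : w ^ 2 = M ^ 2 * p / (γ * a * Real.exp 1) := by
      rw [hw, div_pow, mul_pow, Real.sq_sqrt (by positivity), Real.sq_sqrt (by positivity)]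
    have huw : 0 ≤ u * w := by positivity
    have hlK : (p : ℝ) * Real.log K ≤ p * (2 * ((n : ℝ) ^ a / (a * Real.exp 1) / γ)) := by
      refine mul_le_mul_of_nonneg_left (hlogK.trans ?_) (by positivity)
      gcongr
    have hl2' : Real.log 2 ≤ Real.log 2 * (n : ℝ) ^ a := le_mul_of_one_le_right hl2.le hna1
    rw [div_pow, le_div_iff₀ (by positivity)]
    calc 2 * (M ^ 2 / n) * (Real.log 2 + p * Real.log K) * q ^ 2
        ≤ 2 * (M ^ 2 / n) * (Real.log 2 * (n : ℝ) ^ a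
            + p * (2 * ((n : ℝ) ^ a / (a * Real.exp 1) / γ))) * q ^ 2 := by
          gcongr
      _ = (q ^ 2 * (n : ℝ) ^ a) / n * (M ^ 2 * (2 * Real.log 2)
            + 4 * (M ^ 2 * p / (γ * a * Real.exp 1))) := by
          field_simp; ring
      _ = u ^ 2 + 4 * w ^ 2 := by rw [hq2, hu2, hw2, div_self hn0.ne', one_mul]
      _ ≤ (u + 2 * w) ^ 2 := by nlinarith
  have hpos : 0 ≤ M * √(2 * Real.log 2) / q := by positivity
  calc _ ≤ 2 * (L * D ^ γ * (p : ℝ) ^ (γ / 2) / q)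
        + (M * √(2 * Real.log 2) + 2 * (M * √(p : ℝ) / √(γ * a * Real.exp 1))) / q := by
        linarith
    _ ≤ _ := by
        rw [constNF, ← ha]
        rw [add_div] at *
        have : 2 * (L * D ^ γ * (p : ℝ) ^ (γ / 2) + M * √(2 * Real.log 2)
            + M * √(p : ℝ) / √(γ * a * Real.exp 1)) / q
          = 2 * (L * D ^ γ * (p : ℝ) ^ (γ / 2) / q) + 2 * (M * √(2 * Real.log 2) / q)
            + 2 * (M * √(p : ℝ) / √(γ * a * Real.exp 1)) / q := by ring
        rw [this]
        linarith

/-! ### The uniform deviation: regularity, mean and tail -/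

section UniformDeviation

variable {p n : ℕ} {S : Type*}

/-- The largest deviation over `X` of the sample average objective from `f`. -/
def uniformDev (X : Set (Vec p)) (F : Vec p → S → ℝ) (f : Vec p → ℝ) (s : Fin n → S) : ℝ :=
  ⨆ x : X, |saaObj F s x - f x|

theorem abs_saaObj_le {F : Vec p → S → ℝ} (hn : 0 < n) {M : ℝ} {x : Vec p}
    (hF : ∀ z, |F x z| ≤ M) (s : Fin n → S) : |saaObj F s x| ≤ M := by
  have hn' : (0 : ℝ) < n := by exact_mod_cast hn
  rw [saaObj, abs_mul, abs_of_pos (by positivity), one_div, inv_mul_le_iff₀ hn']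
  refine (Finset.abs_sum_le_sum_abs _ _).trans ?_
  refine (Finset.sum_le_sum fun i _ => hF (s i)).trans (by simp)

theorem abs_saaObj_sub_saaObj_le {F : Vec p → S → ℝ} (hn : 0 < n) {c : ℝ} {x y : Vec p}
    (hF : ∀ z, |F x z - F y z| ≤ c) (s : Fin n → S) : |saaObj F s x - saaObj F s y| ≤ c := by
  have := abs_saaObj_le (F := fun _ z => F x z - F y z) (x := x) hn hF s
  rwa [saaObj, Finset.sum_sub_distrib, mul_sub] at this

theorem abs_saaObj_update_sub_le {F : Vec p → S → ℝ} {M : ℝ} {x : Vec p}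
    (hF : ∀ z, |F x z| ≤ M) (s : Fin n → S) (i : Fin n) (z : S) :
    |saaObj F (Function.update s i z) x - saaObj F s x| ≤ 2 * M / n := by
  have hM : |F x z - F x (s i)| ≤ 2 * M :=
    (abs_sub _ _).trans (by linarith [hF z, hF (s i)])
  have hsum : ∑ j, F x (Function.update s i z j) - ∑ j, F x (s j) = F x z - F x (s i) := by
    rw [← Finset.sum_sub_distrib, Finset.sum_eq_single i]
    · simp
    · intro j _ hj; simp [hj]
    · simp
  rw [saaObj, saaObj, ← mul_sub, hsum, abs_mul, abs_of_nonneg (by positivity), one_div,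
    inv_mul_eq_div]
  gcongr

theorem measurable_saaObj [MeasurableSpace S] {F : Vec p → S → ℝ} {x : Vec p}
    (hF : Measurable (F x)) : Measurable fun s : Fin n → S => saaObj F s x := by
  unfold saaObj
  fun_prop

theorem integral_saaObj [MeasurableSpace S] {ν : Measure S} [IsProbabilityMeasure ν] (hn : 0 < n)
    {F : Vec p → S → ℝ} {x : Vec p} (hF : Measurable (F x)) {M : ℝ} (hM : ∀ z, |F x z| ≤ M) :
    ∫ s : Fin n → S, saaObj F s x ∂(Measure.pi fun _ => ν) = ∫ z, F x z ∂ν := by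
  have hn' : (0 : ℝ) < n := by exact_mod_cast hn
  have hi : ∀ i : Fin n, Integrable (fun s : Fin n → S => F x (s i)) (Measure.pi fun _ => ν) :=
    fun i => integrable_of_measurable_of_abs_le (by fun_prop) fun s => hM (s i)
  have he : ∀ i : Fin n, ∫ s : Fin n → S, F x (s i) ∂(Measure.pi fun _ => ν) = ∫ z, F x z ∂ν := by
    intro i
    have := (measurePreserving_eval (fun _ : Fin n => ν) i).map_eq
    have h := integral_map (μ := Measure.pi fun _ : Fin n => ν) (φ := Function.eval i)
      (measurable_pi_apply i).aemeasurable (f := F x) hF.aestronglyMeasurable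
    rw [this] at h
    exact h.symm
  unfold saaObj
  rw [integral_const_mul, integral_finsetSum _ fun i _ => hi i]
  simp only [he, Finset.sum_const, Finset.card_univ, Fintype.card_fin, nsmul_eq_mul]
  field_simp

theorem continuousOn_of_holder {X : Set (Vec p)} {g : Vec p → ℝ} {L γ : ℝ} (hγ0 : 0 < γ)
    (hg : ∀ x ∈ X, ∀ y ∈ X, |g x - g y| ≤ L * ‖x - y‖ ^ γ) : ContinuousOn g X := by
  intro x hx
  refine tendsto_iff_dist_tendsto_zero.2 ?_
  have hlim : Filter.Tendsto (fun y => L * ‖y - x‖ ^ γ) (nhdsWithin x X) (nhds 0) := by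
    have hc : Continuous fun y : Vec p => L * ‖y - x‖ ^ γ :=
      continuous_const.mul ((continuous_norm.comp (continuous_id.sub continuous_const)).rpow_const
        fun _ => Or.inr hγ0.le)
    have := (hc.tendsto x).mono_left (nhdsWithin_le_nhds (s := X))
    simpa [Real.zero_rpow hγ0.ne'] using this
  refine squeeze_zero' (Filter.Eventually.of_forall fun _ => dist_nonneg) ?_ hlim
  filter_upwards [self_mem_nhdsWithin] with y hy
  exact hg y hy x hx

/-- A supremum of a continuous function is the supremum over a dense sequence. -/
theorem ciSup_eq_ciSup_of_denseRange {α ι : Type*} [TopologicalSpace α] [Nonempty ι] {u : ι → α}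
    (hu : DenseRange u) {g : α → ℝ} (hg : Continuous g) (hb : BddAbove (Set.range g)) :
    ⨆ x, g x = ⨆ k, g (u k) := by
  have : Nonempty α := ⟨u (Classical.arbitrary ι)⟩
  have hb' : BddAbove (Set.range fun k => g (u k)) :=
    hb.mono (by rintro _ ⟨k, rfl⟩; exact ⟨u k, rfl⟩)
  refine le_antisymm (ciSup_le fun x => ?_) (ciSup_le fun k => le_ciSup hb (u k))
  exact hu.induction_on (p := fun x => g x ≤ ⨆ k, g (u k)) x
    (isClosed_le hg continuous_const) fun k => le_ciSup hb' k

section Deviation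

variable {X : Set (Vec p)} {F : Vec p → S → ℝ} {f : Vec p → ℝ} {M : ℝ}

theorem abs_saaObj_sub_le_two_mul (hn : 0 < n) (hM : ∀ x ∈ X, ∀ z, |F x z| ≤ M)
    (hf : ∀ x ∈ X, |f x| ≤ M) (s : Fin n → S) {x : Vec p} (hx : x ∈ X) :
    |saaObj F s x - f x| ≤ 2 * M :=
  (abs_sub _ _).trans (by linarith [abs_saaObj_le hn (hM x hx) s, hf x hx])

theorem bddAbove_deviation (hn : 0 < n) (hM : ∀ x ∈ X, ∀ z, |F x z| ≤ M)
    (hf : ∀ x ∈ X, |f x| ≤ M) (s : Fin n → S) :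
    BddAbove (Set.range fun x : X => |saaObj F s x - f x|) :=
  ⟨2 * M, by rintro _ ⟨x, rfl⟩; exact abs_saaObj_sub_le_two_mul hn hM hf s x.2⟩

theorem abs_saaObj_sub_le_uniformDev (hn : 0 < n) (hM : ∀ x ∈ X, ∀ z, |F x z| ≤ M)
    (hf : ∀ x ∈ X, |f x| ≤ M) (s : Fin n → S) {x : Vec p} (hx : x ∈ X) :
    |saaObj F s x - f x| ≤ uniformDev X F f s :=
  le_ciSup (bddAbove_deviation hn hM hf s) ⟨x, hx⟩

theorem uniformDev_nonneg (s : Fin n → S) : 0 ≤ uniformDev X F f s :=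
  Real.iSup_nonneg fun _ => abs_nonneg _

theorem abs_uniformDev_le (hX : X.Nonempty) (hn : 0 < n) (hM : ∀ x ∈ X, ∀ z, |F x z| ≤ M)
    (hf : ∀ x ∈ X, |f x| ≤ M) (s : Fin n → S) : |uniformDev X F f s| ≤ 2 * M := by
  have := hX.to_subtype
  rw [abs_of_nonneg (uniformDev_nonneg s)]
  exact ciSup_le fun x => abs_saaObj_sub_le_two_mul hn hM hf s x.2

/-- A supremum moves by no more than the largest movement of its members, so the constant is the one
for a single `x`. -/
theorem abs_uniformDev_update_sub_le (hX : X.Nonempty) (hn : 0 < n)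
    (hM : ∀ x ∈ X, ∀ z, |F x z| ≤ M) (hf : ∀ x ∈ X, |f x| ≤ M) (s : Fin n → S) (i : Fin n) (z : S) :
    |uniformDev X F f (Function.update s i z) - uniformDev X F f s| ≤ 2 * M / n := by
  have := hX.to_subtype
  have key : ∀ s s' : Fin n → S, (∀ x ∈ X, |saaObj F s x - saaObj F s' x| ≤ 2 * M / n) →
      uniformDev X F f s - uniformDev X F f s' ≤ 2 * M / n := by
    intro s s' h
    rw [sub_le_iff_le_add]
    refine ciSup_le fun x => ?_
    have h1 := abs_saaObj_sub_le_uniformDev hn hM hf s' x.2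
    have h2 := abs_sub_le (saaObj F s x) (saaObj F s' x) (f x)
    linarith [h x x.2]
  rw [abs_le]
  constructor
  · have := key s (Function.update s i z) fun x hx => by
      rw [abs_sub_comm]; exact abs_saaObj_update_sub_le (hM x hx) s i z
    linarith
  · exact key _ _ fun x hx => abs_saaObj_update_sub_le (hM x hx) s i z

/-- Continuity in `x` reduces the uncountable supremum to one over a dense sequence. -/
theorem measurable_uniformDev [MeasurableSpace S] (hX : X.Nonempty) (hn : 0 < n)
    (hM : ∀ x ∈ X, ∀ z, |F x z| ≤ M) (hf : ∀ x ∈ X, |f x| ≤ M)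
    (hFm : ∀ x ∈ X, Measurable (F x)) (hFc : ∀ z, ContinuousOn (fun x => F x z) X)
    (hfc : ContinuousOn f X) : Measurable fun s : Fin n → S => uniformDev X F f s := by
  have := hX.to_subtype
  have hc : ∀ s : Fin n → S, Continuous fun x : X => |saaObj F s x - f x| := by
    intro s
    have h1 : ∀ z, Continuous fun x : X => F x z := fun z => (hFc z).domRestrict
    have h2 : Continuous fun x : X => f x := hfc.domRestrict
    exact ((continuous_const.mul (continuous_finsetSum _ fun i _ => h1 (s i))).sub h2).abs
  have heq : (fun s : Fin n → S => uniformDev X F f s)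
      = fun s => ⨆ k, |saaObj F s (TopologicalSpace.denseSeq X k)
          - f (TopologicalSpace.denseSeq X k)| := by
    funext s
    exact ciSup_eq_ciSup_of_denseRange (TopologicalSpace.denseRange_denseSeq X) (hc s)
      (bddAbove_deviation hn hM hf s)
  rw [heq]
  refine Measurable.iSup fun k => ?_
  exact ((measurable_saaObj (hFm _ (TopologicalSpace.denseSeq X k).2)).sub_const _).abs

/-- The uniform law of large numbers in mean, by a net of `X` and the sub-Gaussian maximal
inequality. -/
theorem integral_uniformDev_le [MeasurableSpace S] {ν : Measure S} [IsProbabilityMeasure ν]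
    (hX : X.Nonempty) {D : ℝ} (hD : 0 ≤ D) (hcube : InCube X D) (hn : 0 < n) {L γ lam : ℝ}
    (hL : 0 ≤ L) (hγ0 : 0 < γ) (hγ1 : γ ≤ 1) (hlam0 : 0 < lam) (hlam1 : lam < 1 / 2) (hM0 : 0 < M)
    (hM : ∀ x ∈ X, ∀ z, |F x z| ≤ M) (hFm : ∀ x ∈ X, Measurable (F x))
    (hFh : ∀ x ∈ X, ∀ y ∈ X, ∀ z, |F x z - F y z| ≤ L * ‖x - y‖ ^ γ)
    (hfh : ∀ x ∈ X, ∀ y ∈ X, |f x - f y| ≤ L * ‖x - y‖ ^ γ)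
    (hf : ∀ x ∈ X, f x = ∫ z, F x z ∂ν) (hfM : ∀ x ∈ X, |f x| ≤ M) :
    ∫ s : Fin n → S, uniformDev X F f s ∂(Measure.pi fun _ => ν)
      ≤ 2 * constNF p L D γ M lam / (n : ℝ) ^ lam := by
  have hXt := hX.to_subtype
  have hn' : (0 : ℝ) < n := by exact_mod_cast hn
  obtain ⟨K, hK, hKle⟩ := exists_mesh_le p hL hD hγ0 hγ1 hM0 hlam0 hlam1 hn
  obtain ⟨T, hTX, hTcard, hTnet⟩ := hcube.exists_net hD hK
  refine le_trans ?_ hKle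
  have hsg : ∀ x ∈ T, HasSubgaussianMGF (fun s : Fin n → S => saaObj F s x - f x)
      (Real.toNNReal (M ^ 2 / n)) (Measure.pi fun _ => ν) := by
    intro x hx
    have h := hasSubgaussianMGF_of_boundedDifferences ν (n := n)
      (measurable_saaObj (hFm x (hTX x hx))) (abs_saaObj_le hn (hM x (hTX x hx)))
      (abs_saaObj_update_sub_le (hM x (hTX x hx)))
    rw [integral_saaObj hn (hFm x (hTX x hx)) (hM x (hTX x hx)), ← hf x (hTX x hx)] at h
    convert h using 2
    field_simp
    norm_num
  have hpos : 0 < M ^ 2 / n := by positivity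
  have hint : Integrable (fun s : Fin n → S => uniformDev X F f s) (Measure.pi fun _ => ν) :=
    integrable_of_measurable_of_abs_le
      (measurable_uniformDev hX hn hM hfM hFm
        (fun z => continuousOn_of_holder hγ0 fun x hx y hy => hFh x hx y hy z)
        (continuousOn_of_holder hγ0 hfh))
      (abs_uniformDev_le hX hn hM hfM)
  have := integral_le_of_hasSubgaussianMGF (pow_pos hK p) hTcard (Real.toNNReal_pos.2 hpos) hsg
    hint (B := 2 * (L * (√p * (D / K)) ^ γ)) ?_
  · rwa [Real.coe_toNNReal _ hpos.le] at this
  intro s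
  set B := L * (√p * (D / K)) ^ γ with hB
  have hTne : T.Nonempty := by
    obtain ⟨x, hx⟩ := hX
    obtain ⟨y, hy, _⟩ := hTnet x hx
    exact ⟨y, hy⟩
  -- The worst net point controls every `x`. The error is `2 * B` because both the sample average
  -- and `f` change by at most `B` between `x` and its net point.
  obtain ⟨i, hi, hmax⟩ := T.exists_max_image (fun x => |saaObj F s x - f x|) hTne
  refine ⟨i, hi, ciSup_le fun x => ?_⟩
  obtain ⟨y, hy, hxy⟩ := hTnet x x.2
  have hγle : L * ‖(x : Vec p) - y‖ ^ γ ≤ B := by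
    rw [hB]; gcongr
  have h1 := abs_saaObj_sub_saaObj_le hn (fun z => hFh x x.2 y (hTX y hy) z) s
  have h2 := hfh x x.2 y (hTX y hy)
  have h3 := hmax y hy
  have h4 : |saaObj F s x - f x| ≤ |saaObj F s x - saaObj F s y|
      + |saaObj F s y - f y| + |f x - f y| := by
    rw [abs_sub_comm (f x)]
    exact (abs_sub_le _ (f y) _).trans (by gcongr; exact abs_sub_le _ _ _)
  linarith

/-- The concentration of the uniform deviation around its mean. -/
theorem measure_uniformDev_ge_le [MeasurableSpace S] {ν : Measure S} [IsProbabilityMeasure ν]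
    (hX : X.Nonempty) (hn : 0 < n) (hM : ∀ x ∈ X, ∀ z, |F x z| ≤ M) (hf : ∀ x ∈ X, |f x| ≤ M)
    (hdm : Measurable fun s : Fin n → S => uniformDev X F f s) {r : ℝ} (hr : 0 ≤ r) :
    (Measure.pi fun _ => ν).real {s : Fin n → S | r ≤ uniformDev X F f s
        - ∫ s : Fin n → S, uniformDev X F f s ∂(Measure.pi fun _ => ν)}
      ≤ Real.exp (-(n * r ^ 2 / (2 * M ^ 2))) := by
  refine (measure_ge_le_of_boundedDifferences ν hdm (abs_uniformDev_le hX hn hM hf)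
    (abs_uniformDev_update_sub_le hX hn hM hf) hr).trans (Real.exp_le_exp.2 (le_of_eq ?_))
  have hn' : (n : ℝ) ≠ 0 := by exact_mod_cast hn.ne'
  -- For `M = 0` both exponents vanish by the convention on division by zero.
  by_cases hM0 : M = 0
  · simp [hM0]
  · field_simp

end Deviation

end UniformDeviation

/-! ### Deterministic stability of the compromise decision -/

section Deterministic

variable {p : ℕ} {X : Set (Vec p)} {f : Vec p → ℝ}

theorem epsSolSet_nonempty (hX : X.Nonempty) (hXc : IsCompact X) (hf : ContinuousOn f X) {ε : ℝ}
    (hε : 0 ≤ ε) : (epsSolSet X f ε).Nonempty := by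
  obtain ⟨x, hx, hmin⟩ := hXc.exists_sInf_image_eq hX hf
  exact ⟨x, hx, by linarith⟩

theorem bddBelow_norm_sub (a : Vec p) (B : Set (Vec p)) :
    BddBelow (Set.range fun b : B => ‖a - b‖) :=
  ⟨0, by rintro _ ⟨b, rfl⟩; exact norm_nonneg _⟩

theorem pessimisticDist_nonneg (A B : Set (Vec p)) : 0 ≤ pessimisticDist A B :=
  Real.iSup_nonneg fun _ => Real.iInf_nonneg fun _ => norm_nonneg _

/-- Nonnegativity of `c` covers an empty `A`, where the real supremum is `0`. -/
theorem pessimisticDist_le {A B : Set (Vec p)} {c : ℝ} (hc : 0 ≤ c)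
    (h : ∀ a ∈ A, ⨅ b : B, ‖a - b‖ ≤ c) : pessimisticDist A B ≤ c :=
  Real.iSup_le (fun a => h a a.2) hc

theorem pessimisticDist_le_diam (hX : Bornology.IsBounded X) {A B : Set (Vec p)} (hA : A ⊆ X)
    (hB : B ⊆ X) (hBne : B.Nonempty) : pessimisticDist A B ≤ Metric.diam X := by
  refine pessimisticDist_le Metric.diam_nonneg fun a ha => ?_
  obtain ⟨b, hb⟩ := hBne
  refine (ciInf_le (bddBelow_norm_sub a B) ⟨b, hb⟩).trans ?_
  rw [← dist_eq_norm]
  exact Metric.dist_le_diam_of_mem hX (hA ha) (hB hb)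

/-- The distance of an `ε + η`-optimal point of a convex function to the `ε`-optimal points. -/
theorem iInf_norm_sub_epsSolSet_le (hX : X.Nonempty) (hXc : IsCompact X) (hf : ConvexOn ℝ X f)
    (hfc : ContinuousOn f X) {ε η : ℝ} (hε : 0 < ε) (hη : 0 ≤ η) {a : Vec p} (ha : a ∈ X)
    (hfa : ∀ y ∈ X, f a ≤ f y + ε + η) :
    ⨅ b : epsSolSet X f ε, ‖a - b‖ ≤ Metric.diam X * η / ε := by
  obtain ⟨x, hx, hmin⟩ := hXc.exists_sInf_image_eq hX hfc
  have hεη : 0 < ε + η := by linarith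
  -- The fraction of the way to a minimizer that lowers the gap to `ε`: `(1 - t) * (ε + η) = ε`.
  set t := η / (ε + η) with ht
  have ht0 : 0 ≤ t := by positivity
  have ht1 : t ≤ 1 := by rw [ht, div_le_one hεη]; linarith
  have htm : (1 - t) * (ε + η) = ε := by rw [ht]; field_simp; ring
  have hb : (1 - t) • a + t • x ∈ epsSolSet X f ε := by
    refine ⟨hf.1 ha hx (by linarith) ht0 (by ring), ?_⟩
    have h1 := hf.2 ha hx (show 0 ≤ 1 - t by linarith) ht0 (by ring)
    simp only [smul_eq_mul] at h1
    have h2 := mul_le_mul_of_nonneg_left (hfa x hx) (show 0 ≤ 1 - t by linarith)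
    rw [hmin]
    nlinarith
  refine (ciInf_le (bddBelow_norm_sub a _) ⟨_, hb⟩).trans ?_
  have h3 : a - ((1 - t) • a + t • x) = t • (a - x) := by module
  rw [h3, norm_smul, Real.norm_of_nonneg ht0, mul_comm, mul_div_assoc, ← dist_eq_norm]
  have h4 : t ≤ η / ε := by rw [ht]; gcongr; linarith
  exact mul_le_mul (Metric.dist_le_diam_of_mem hXc.isBounded ha hx) h4 ht0 Metric.diam_nonneg

/-- Solving for `r` directly would leave a term of order `√η`. The a priori bound `r ≤ D` makes it
linear: with `a = √(ε / ρ)`, failure of the claim forces `2 * a < r ≤ D`, and factoring `r ^ 2 - 4 *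
a ^ 2` then bounds `r - 2 * a` by a fraction of `D * η / ε`. -/
theorem le_of_half_mul_sq_le {r D ε η ρ : ℝ} (hr : 0 ≤ r) (hrD : r ≤ D) (hε : 0 < ε) (hη : 0 ≤ η)
    (hρ : 0 < ρ) (h : ρ / 2 * r ^ 2 ≤ 2 * ε + η) : r ≤ D * η / ε + 2 * √(ε / ρ) := by
  set a := √(ε / ρ) with ha
  have ha0 : 0 < a := Real.sqrt_pos.2 (by positivity)
  have ha2 : a ^ 2 = ε / ρ := Real.sq_sqrt (by positivity)
  have hD : 0 ≤ D * η / ε := by have := hr.trans hrD; positivity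
  by_contra! hlt
  have hr2 : 2 * a < r := by linarith
  have hsq : r ^ 2 ≤ 4 * a ^ 2 + 2 * (η / ε) * a ^ 2 := by
    rw [ha2]
    have : 4 * (ε / ρ) + 2 * (η / ε) * (ε / ρ) = (2 * ε + η) * 2 / ρ := by field_simp; ring
    rw [this, le_div_iff₀ hρ]; linarith
  rw [mul_div_assoc] at hlt hD
  have hk : 0 ≤ η / ε := by positivity
  have h1 : (r - 2 * a) * (4 * a) ≤ 2 * (η / ε) * a ^ 2 := by nlinarith
  have h2 : r - 2 * a ≤ (η / ε) * a / 2 := by nlinarith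
  have h3 : (η / ε) * a ≤ (η / ε) * D := mul_le_mul_of_nonneg_left (by linarith) hk
  nlinarith

variable {m : ℕ} {φ h : Fin m → Vec p → ℝ} {d : Fin m → Vec p} {δ : Fin m → ℝ} {ε₁ : ℝ}

theorem average_mem (hXconvex : Convex ℝ X) (hm : 0 < m) (hd : ∀ i, d i ∈ X) :
    (1 / (m : ℝ)) • ∑ i, d i ∈ X := by
  have hm' : (0 : ℝ) < m := by exact_mod_cast hm
  rw [Finset.smul_sum]
  exact hXconvex.sum_mem (fun _ _ => by positivity) (by simp [hm'.ne']) fun i _ => hd i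

theorem ConvexOn.map_average_le {g : Vec p → ℝ} (hg : ConvexOn ℝ X g) (hm : 0 < m)
    (hd : ∀ i, d i ∈ X) : g ((1 / (m : ℝ)) • ∑ i, d i) ≤ 1 / (m : ℝ) * ∑ i, g (d i) := by
  have hm' : (0 : ℝ) < m := by exact_mod_cast hm
  rw [Finset.smul_sum, Finset.mul_sum]
  exact hg.map_sum_le (fun _ _ => by positivity) (by simp [hm'.ne']) fun i _ => hd i

/-- The average of the decisions is nearly optimal for the true problem. -/
theorem map_average_decision_le (hf : ConvexOn ℝ X f) (hm : 0 < m) (hd : ∀ i, d i ∈ X)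
    (hδ : ∀ i, ∀ x ∈ X, |φ i x - f x| ≤ δ i) (hle : ∀ i, ∀ x ∈ X, h i x ≤ φ i x)
    (hge : ∀ i, ∀ x ∈ X, φ i (d i) - ε₁ ≤ h i x) {y : Vec p} (hy : y ∈ X) :
    f ((1 / (m : ℝ)) • ∑ i, d i) ≤ f y + ε₁ + 2 / m * ∑ i, δ i := by
  have hm' : (0 : ℝ) < m := by exact_mod_cast hm
  refine (ConvexOn.map_average_le hf hm hd).trans ?_
  have hterm : ∀ i, f (d i) ≤ f y + ε₁ + 2 * δ i := by
    intro i
    have h1 := abs_le.1 (hδ i (d i) (hd i))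
    have h2 := abs_le.1 (hδ i y hy)
    linarith [hle i y hy, hge i y hy, h1.1, h2.2]
  have hsum := Finset.sum_le_sum fun i (_ : i ∈ Finset.univ) => hterm i
  rw [Finset.sum_add_distrib, ← Finset.mul_sum, Finset.sum_const, Finset.card_univ,
    Fintype.card_fin, nsmul_eq_mul] at hsum
  calc 1 / (m : ℝ) * ∑ i, f (d i)
      ≤ 1 / (m : ℝ) * (m * (f y + ε₁) + 2 * ∑ i, δ i) := by gcongr
    _ = _ := by field_simp

/-- A nearly optimal decision of the compromise problem is close to the average decision. -/
theorem half_mul_norm_sub_sq_le (hφ : ∀ i, ConvexOn ℝ X (φ i)) (hm : 0 < m) (hd : ∀ i, d i ∈ X)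
    (hδ : ∀ i, ∀ x ∈ X, |φ i x - f x| ≤ δ i) (hle : ∀ i, ∀ x ∈ X, h i x ≤ φ i x)
    (hge : ∀ i, ∀ x ∈ X, φ i (d i) - ε₁ ≤ h i x) {ρ ε : ℝ} {x : Vec p} (hx : x ∈ X)
    (hopt : 1 / (m : ℝ) * ∑ i, h i x + ρ / 2 * ‖x - (1 / (m : ℝ)) • ∑ i, d i‖ ^ 2
      ≤ 1 / (m : ℝ) * ∑ i, h i ((1 / (m : ℝ)) • ∑ i, d i) + ε) :
    ρ / 2 * ‖x - (1 / (m : ℝ)) • ∑ i, d i‖ ^ 2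
      ≤ ε + ε₁ + 2 * (m - 1) / (m : ℝ) ^ 2 * ∑ i, δ i := by
  have hm' : (0 : ℝ) < m := by exact_mod_cast hm
  have hXconvex : Convex ℝ X := (hφ ⟨0, hm⟩).1
  set xb := (1 / (m : ℝ)) • ∑ i, d i with hxb
  have hxbX : xb ∈ X := average_mem hXconvex hm hd
  -- Jensen's inequality bounds `h i xb` by the average of `φ i` over the decisions.
  have hterm : ∀ i, h i xb - h i x ≤ 1 / (m : ℝ) * ∑ j, φ i (d j) - φ i (d i) + ε₁ := by
    intro i
    have := ConvexOn.map_average_le (hφ i) hm hd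
    linarith [hle i xb hxbX, hge i x hx]
  -- Diagonal pairs contribute zero; removing them turns `2 * m` into `2 * (m - 1)`.
  have hpair : ∀ i j, φ i (d j) - φ j (d j) ≤ δ i + δ j - if i = j then 2 * δ i else 0 := by
    intro i j
    split_ifs with hij
    · subst hij; linarith
    · have h1 := abs_le.1 (hδ i (d j) (hd j))
      have h2 := abs_le.1 (hδ j (d j) (hd j))
      linarith [h1.2, h2.1]
  have hpairs : ∑ i, ∑ j, (φ i (d j) - φ j (d j)) ≤ 2 * (m - 1) * ∑ i, δ i := by
    refine (Finset.sum_le_sum fun i _ => Finset.sum_le_sum fun j _ => hpair i j).trans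
      (le_of_eq ?_)
    simp only [Finset.sum_sub_distrib, Finset.sum_add_distrib, Finset.sum_const, Finset.card_univ,
      Fintype.card_fin, nsmul_eq_mul, Finset.sum_ite_eq, Finset.mem_univ, if_true,
      ← Finset.mul_sum]
    ring
  have hsum := Finset.sum_le_sum fun i (_ : i ∈ Finset.univ) => hterm i
  -- Relabelling the own-decision terms pairs two sample averages at the same point `d j`, so that
  -- `f (d j)` cancels in each difference.
  have heq : ∑ i, (1 / (m : ℝ) * ∑ j, φ i (d j) - φ i (d i) + ε₁)
      = 1 / (m : ℝ) * ∑ i, ∑ j, (φ i (d j) - φ j (d j)) + m * ε₁ := by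
    simp only [Finset.sum_add_distrib, Finset.sum_sub_distrib, Finset.sum_const, Finset.card_univ,
      Fintype.card_fin, nsmul_eq_mul, ← Finset.mul_sum]
    field_simp
  rw [heq, Finset.sum_sub_distrib] at hsum
  have hfin : 1 / (m : ℝ) * (∑ i, h i xb - ∑ i, h i x)
      ≤ 1 / (m : ℝ) * (1 / (m : ℝ) * (2 * (m - 1) * ∑ i, δ i) + m * ε₁) := by
    gcongr
    refine hsum.trans ?_
    gcongr
  have heq2 : 1 / (m : ℝ) * (1 / (m : ℝ) * (2 * (m - 1) * ∑ i, δ i) + m * ε₁)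
      = ε₁ + 2 * (m - 1) / (m : ℝ) ^ 2 * ∑ i, δ i := by
    field_simp; ring
  rw [heq2, mul_sub] at hfin
  linarith

/-- The pessimistic distance is controlled by the sum of the uniform deviations. -/
theorem pessimisticDist_epsSolSet_le (hX : X.Nonempty) (hXc : IsCompact X)
    (hf : ConvexOn ℝ X f) (hfc : ContinuousOn f X) (hφ : ∀ i, ConvexOn ℝ X (φ i)) (hm : 0 < m)
    (hd : ∀ i, d i ∈ X) (hδ : ∀ i, ∀ x ∈ X, |φ i x - f x| ≤ δ i)
    (hle : ∀ i, ∀ x ∈ X, h i x ≤ φ i x) (hge : ∀ i, ∀ x ∈ X, φ i (d i) - ε₁ ≤ h i x) {ρ ε : ℝ}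
    (hρ : 0 < ρ) (hε : 0 < ε) (hεε₁ : ε ≤ ε₁) :
    pessimisticDist
        (epsSolSet X (fun x => 1 / (m : ℝ) * ∑ i, h i x
          + ρ / 2 * ‖x - (1 / (m : ℝ)) • ∑ i, d i‖ ^ 2) ε)
        (epsSolSet X f ε)
      ≤ Metric.diam X / ε * (2 * (ε₁ - ε) + (4 * m - 2) / (m : ℝ) ^ 2 * ∑ i, δ i)
        + 2 * √(ε / ρ) := by
  have hm' : (0 : ℝ) < m := by exact_mod_cast hm
  have hm1 : (1 : ℝ) ≤ m := by exact_mod_cast hm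
  have hδ0 : 0 ≤ ∑ i, δ i := Finset.sum_nonneg fun i _ =>
    (abs_nonneg _).trans (hδ i (d i) (hd i))
  have hdiam : 0 ≤ Metric.diam X := Metric.diam_nonneg
  set xb := (1 / (m : ℝ)) • ∑ i, d i with hxb
  have hxbX : xb ∈ X := average_mem hf.1 hm hd
  -- `η₁` is the excess gap of the average decision and `η₂` the excess in the penalty bound; `2 / m
  -- + 2 * (m - 1) / m ^ 2 = (4 * m - 2) / m ^ 2`.
  set η₁ := ε₁ - ε + 2 / m * ∑ i, δ i with hη₁
  set η₂ := ε₁ - ε + 2 * (m - 1) / (m : ℝ) ^ 2 * ∑ i, δ i with hη₂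
  have hη₁0 : 0 ≤ η₁ := add_nonneg (by linarith) (by positivity)
  have hη₂0 : 0 ≤ η₂ := add_nonneg (by linarith)
    (mul_nonneg (div_nonneg (by linarith) (by positivity)) hδ0)
  have hsum : Metric.diam X / ε * (2 * (ε₁ - ε) + (4 * m - 2) / (m : ℝ) ^ 2 * ∑ i, δ i)
      = Metric.diam X * η₂ / ε + Metric.diam X * η₁ / ε := by
    rw [hη₁, hη₂]; field_simp; ring
  have hxbd := iInf_norm_sub_epsSolSet_le hX hXc hf hfc hε hη₁0 hxbX fun y hy => by
    have := map_average_decision_le hf hm hd hδ hle hge hy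
    linarith
  rw [hsum]
  refine pessimisticDist_le (by positivity) fun a ha => ?_
  obtain ⟨haX, ha⟩ := ha
  set G : Vec p → ℝ := fun x => 1 / (m : ℝ) * ∑ i, h i x + ρ / 2 * ‖x - xb‖ ^ 2 with hG
  have hGbdd : BddBelow (G '' X) := by
    refine ⟨1 / (m : ℝ) * ∑ i, (φ i (d i) - ε₁), ?_⟩
    rintro _ ⟨x, hx, rfl⟩
    have h1 : 1 / (m : ℝ) * ∑ i, (φ i (d i) - ε₁) ≤ 1 / (m : ℝ) * ∑ i, h i x := by
      gcongr with i
      exact hge i x hx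
    have h2 : 0 ≤ ρ / 2 * ‖x - xb‖ ^ 2 := by positivity
    simp only [hG]
    linarith
  have hGa : G a ≤ G xb + ε := by
    have := csInf_le hGbdd (Set.mem_image_of_mem G hxbX)
    linarith
  have hGxb : G xb = 1 / (m : ℝ) * ∑ i, h i xb := by simp [hG]
  rw [hGxb] at hGa
  have hsq := half_mul_norm_sub_sq_le hφ hm hd hδ hle hge haX hGa
  have hnorm : ‖a - xb‖ ≤ Metric.diam X * η₂ / ε + 2 * √(ε / ρ) := by
    refine le_of_half_mul_sq_le (norm_nonneg _) ?_ hε hη₂0 hρ (hsq.trans (by linarith))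
    rw [← dist_eq_norm]
    exact Metric.dist_le_diam_of_mem hXc.isBounded haX hxbX
  have hne := (epsSolSet_nonempty hX hXc hfc hε.le).to_subtype
  have htri : ⨅ b : epsSolSet X f ε, ‖a - b‖
      ≤ ‖a - xb‖ + ⨅ b : epsSolSet X f ε, ‖xb - b‖ := by
    rw [← sub_le_iff_le_add']
    refine le_ciInf fun b => ?_
    rw [sub_le_iff_le_add']
    exact (ciInf_le (bddBelow_norm_sub a _) b).trans (norm_sub_le_norm_sub_add_norm_sub _ _ _)
  linarith

end Deterministic

/-! ### Measurability of the pessimistic distance -/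

section Measurability

variable {p : ℕ} {X : Set (Vec p)}

theorem csInf_image_eq_ciInf_of_denseRange {ι : Type*} [Nonempty ι] {u : ι → X}
    (hu : DenseRange u) {g : Vec p → ℝ} (hg : ContinuousOn g X) (hXc : IsCompact X) :
    sInf (g '' X) = ⨅ k, g (u k) := by
  have hb : BddBelow (g '' X) := (hXc.image_of_continuousOn hg).bddBelow
  have hb' : BddBelow (Set.range fun k => g (u k)) :=
    hb.mono (by rintro _ ⟨k, rfl⟩; exact ⟨u k, (u k).2, rfl⟩)
  refine le_antisymm (le_ciInf fun k => csInf_le hb ⟨u k, (u k).2, rfl⟩) ?_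
  have hX : X.Nonempty := ⟨u (Classical.arbitrary ι), (u _).2⟩
  refine le_csInf (hX.image g) ?_
  rintro _ ⟨x, hx, rfl⟩
  exact hu.induction_on (p := fun x : X => ⨅ k, g (u k) ≤ g x) ⟨x, hx⟩
    (isClosed_le continuous_const hg.domRestrict) fun k => ciInf_le hb' k

/-- The supremum of a continuous function over the `ε`-optimal solutions of a convex function is
a supremum over a dense sequence. -/
theorem iSup_epsSolSet_eq {ι : Type*} [Nonempty ι] {u : ι → X} (hu : DenseRange u)
    (hXc : IsCompact X) {G : Vec p → ℝ} (hG : ConvexOn ℝ X G) (hGc : ContinuousOn G X) {ε : ℝ}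
    (hε : 0 < ε) {g : Vec p → ℝ} (hg : Continuous g) (hg0 : ∀ x, 0 ≤ g x) :
    ⨆ a : epsSolSet X G ε, g a
      = ⨆ k, {x : Vec p | G x < (⨅ k', G (u k')) + ε}.indicator g (u k) := by
  have hX : X.Nonempty := ⟨u (Classical.arbitrary ι), (u _).2⟩
  rw [← csInf_image_eq_ciInf_of_denseRange hu hGc hXc]
  set μ := sInf (G '' X) with hμ
  obtain ⟨x₀, hx₀, hmin⟩ := hXc.exists_sInf_image_eq hX hGc
  obtain ⟨C, hC⟩ := (hXc.image hg).bddAbove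
  have hgC : ∀ x ∈ X, g x ≤ C := fun x hx => hC ⟨x, hx, rfl⟩
  have hb1 : BddAbove (Set.range fun a : epsSolSet X G ε => g a) :=
    ⟨C, by rintro _ ⟨a, rfl⟩; exact hgC a a.2.1⟩
  have hb2 : BddAbove (Set.range fun k => {x : Vec p | G x < μ + ε}.indicator g (u k)) := by
    refine ⟨C, ?_⟩
    rintro _ ⟨k, rfl⟩
    exact (Set.indicator_le_self' (fun x _ => hg0 x) _).trans (hgC _ (u k).2)
  set R := ⨆ k, {x : Vec p | G x < μ + ε}.indicator g (u k) with hR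
  have hR0 : 0 ≤ R := Real.iSup_nonneg fun k => Set.indicator_nonneg (fun x _ => hg0 x) _
  -- The strict sublevel set is relatively open in `X`, hence seen by the dense sequence; the zeros
  -- of the indicator are harmless since `g ≥ 0`.
  have hstrict : ∀ a ∈ X, G a < μ + ε → g a ≤ R := by
    intro a ha haG
    by_contra! hlt
    have hopen : IsOpen {x : X | G x < μ + ε ∧ R < g x} :=
      (isOpen_lt hGc.domRestrict continuous_const).inter
        (isOpen_lt continuous_const (hg.comp continuous_subtype_val))
    obtain ⟨k, hk⟩ := hu.exists_mem_open hopen ⟨⟨a, ha⟩, haG, hlt⟩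
    have := le_ciSup hb2 k
    rw [Set.indicator_of_mem (show (u k : Vec p) ∈ {x : Vec p | G x < μ + ε} from hk.1)] at this
    exact absurd (hk.2.trans_le this) (lt_irrefl _)
  refine le_antisymm (Real.iSup_le (fun a => ?_) hR0) (ciSup_le fun k => ?_)
  -- A point of the closed sublevel set is a limit of strict ones: moving it slightly towards the
  -- minimizer `x₀` strictly improves on the level `μ + ε`, as `ε > 0`.
  · obtain ⟨a, ha, haG⟩ := a
    have hlim : Filter.Tendsto (fun t : ℝ => g ((1 - t) • a + t • x₀))
        (nhdsWithin 0 (Set.Ioi 0)) (nhds (g a)) := by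
      have hc : Continuous fun t : ℝ => g ((1 - t) • a + t • x₀) := by fun_prop
      have := (hc.tendsto 0).mono_left (nhdsWithin_le_nhds (s := Set.Ioi 0))
      simpa using this
    refine le_of_tendsto hlim ?_
    filter_upwards [Ioc_mem_nhdsGT (zero_lt_one (α := ℝ))] with t ht
    refine hstrict _ (hG.1 ha hx₀ (by linarith [ht.2]) ht.1.le (by ring)) ?_
    have h1 := hG.2 ha hx₀ (show 0 ≤ 1 - t by linarith [ht.2]) ht.1.le (by ring)
    simp only [smul_eq_mul] at h1
    have h2 := mul_le_mul_of_nonneg_left haG (show 0 ≤ 1 - t by linarith [ht.2])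
    have h3 := mul_pos ht.1 hε
    rw [← hμ] at hmin h2
    rw [← hmin] at h1
    linarith
  · by_cases hk : G (u k) < μ + ε
    · rw [Set.indicator_of_mem (show (u k : Vec p) ∈ {x : Vec p | G x < μ + ε} from hk)]
      exact le_ciSup hb1 ⟨u k, (u k).2, hk.le⟩
    · rw [Set.indicator_of_notMem (show (u k : Vec p) ∉ {x : Vec p | G x < μ + ε} from hk)]
      exact Real.iSup_nonneg fun a => hg0 a

/-- Measurability of the pessimistic distance from the `ε`-optimal solution set of a random convex
function. -/
theorem measurable_pessimisticDist_epsSolSet {T : Type*} [MeasurableSpace T] (hX : X.Nonempty)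
    (hXc : IsCompact X) {G : T → Vec p → ℝ} (hG : ∀ s, ConvexOn ℝ X (G s))
    (hGc : ∀ s, ContinuousOn (G s) X) (hGm : ∀ x ∈ X, Measurable fun s => G s x) {ε : ℝ}
    (hε : 0 < ε) (B : Set (Vec p)) :
    Measurable fun s => pessimisticDist (epsSolSet X (G s) ε) B := by
  have := hX.to_subtype
  set u := TopologicalSpace.denseSeq X
  have hu : DenseRange u := TopologicalSpace.denseRange_denseSeq X
  have hinf : (fun a : Vec p => ⨅ b : B, ‖a - b‖) = fun a => Metric.infDist a B := by
    funext a
    rw [Metric.infDist_eq_iInf]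
    simp only [dist_eq_norm]
  have hg : Continuous fun a : Vec p => ⨅ b : B, ‖a - b‖ := by
    rw [hinf]; exact Metric.continuous_infDist_pt B
  have heq : (fun s => pessimisticDist (epsSolSet X (G s) ε) B) = fun s => ⨆ k,
      {s | G s (u k) < (⨅ k', G s (u k')) + ε}.indicator
        (fun _ => ⨅ b : B, ‖(u k : Vec p) - b‖) s := by
    funext s
    exact iSup_epsSolSet_eq hu hXc (hG s) (hGc s) hε hg
      fun x => Real.iInf_nonneg fun _ => norm_nonneg _
  rw [heq]
  have hm : Measurable fun s => ⨅ k', G s (u k') := Measurable.iInf fun k' => hGm _ (u k').2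
  exact Measurable.iSup fun k =>
    measurable_const.indicator (measurableSet_lt (hGm _ (u k).2) (hm.add_const ε))

variable {m n : ℕ} {S : Type*}

theorem convexOn_sup'_affine {ι : Type*} {s : Finset ι} (hs : s.Nonempty) {g : ι → Vec p → ℝ}
    (hg : ∀ i ∈ s, ConvexOn ℝ Set.univ (g i)) :
    ConvexOn ℝ Set.univ fun x => s.sup' hs fun i => g i x := by
  have : (fun x => s.sup' hs fun i => g i x) = s.sup' hs g := by
    funext x; rw [Finset.sup'_apply]
  rw [this]
  exact Finset.sup'_induction hs g (fun _ h₁ _ h₂ => h₁.sup h₂) hg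

theorem convexOn_const_add_inner (a : ℝ) (v c : Vec p) (b : ℝ) :
    ConvexOn ℝ Set.univ fun x => a + inner ℝ v (x - c) - b := by
  refine ⟨convex_univ, fun x _ y _ s t _ _ hst => le_of_eq ?_⟩
  simp only [inner_sub_right, inner_add_right, inner_smul_right, smul_eq_mul]
  linear_combination (inner ℝ v c - a + b) * hst

theorem CuttingPlaneOutput.convexOn_approx (A : CuttingPlaneOutput p n S) (s : Fin n → S) :
    ConvexOn ℝ Set.univ (A.approx s) := by
  refine convexOn_sup'_affine _ fun q _ => ?_
  simpa using convexOn_const_add_inner q.1 q.2 0 0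

theorem CuttingPlaneOutput.continuous_approx (A : CuttingPlaneOutput p n S) (s : Fin n → S) :
    Continuous (A.approx s) :=
  Continuous.finset_sup'_apply _ fun q _ => by fun_prop

variable (F : Vec p → S → ℝ) (A : CuttingPlaneOutput p n S)
  (sub : Vec p → (Fin n → S) → Vec p) (ε₂ ρ : ℝ) (s : Fin (m * n) → S)

theorem augmented_eq_max_sup' (i : Fin m) :
    augmented F A sub ε₂ s i = fun x => max (A.approx (replication s i) x)
      (Finset.univ.sup' ⟨i, Finset.mem_univ i⟩ fun j : Fin m =>
        (saaObj F (replication s i) (A.decision (replication s j))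
          + inner ℝ (sub (A.decision (replication s j)) (replication s i))
            (x - A.decision (replication s j)) - ε₂)) := by
  have : Nonempty (Fin m) := ⟨i⟩
  funext x
  rw [augmented, Finset.sup'_univ_eq_ciSup]

theorem convexOn_augmented (i : Fin m) : ConvexOn ℝ Set.univ (augmented F A sub ε₂ s i) := by
  rw [augmented_eq_max_sup']
  exact (A.convexOn_approx _).sup
    (convexOn_sup'_affine _ fun j _ => convexOn_const_add_inner _ _ _ _)

theorem continuous_augmented (i : Fin m) : Continuous (augmented F A sub ε₂ s i) := by
  rw [augmented_eq_max_sup']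
  exact (A.continuous_approx _).max (Continuous.finset_sup'_apply _ fun q _ => by fun_prop)

theorem convexOn_compromiseObj (hρ : 0 ≤ ρ) :
    ConvexOn ℝ Set.univ (compromiseObj F A sub ε₂ ρ s) := by
  refine ConvexOn.add ?_ ?_
  · refine ConvexOn.smul (c := 1 / (m : ℝ)) (by positivity) ?_
    refine ⟨convex_univ, fun x hx y hy a b ha hb hab => ?_⟩
    simp only [smul_eq_mul, Finset.mul_sum, ← Finset.sum_add_distrib]
    exact Finset.sum_le_sum fun i _ => (convexOn_augmented F A sub ε₂ s i).2 hx hy ha hb hab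
  · refine ConvexOn.smul (c := ρ / 2) (by positivity) ?_
    have := (convexOn_dist ((1 / (m : ℝ)) • ∑ i : Fin m, A.decision (replication s i))
      convex_univ).pow (fun _ _ => dist_nonneg) 2
    simp only [dist_eq_norm] at this
    exact this

theorem continuous_compromiseObj : Continuous (compromiseObj F A sub ε₂ ρ s) := by
  have := fun i => continuous_augmented F A sub ε₂ s i
  unfold compromiseObj
  fun_prop

variable {F A sub}

theorem measurable_replication [MeasurableSpace S] (i : Fin m) :
    Measurable fun s : Fin (m * n) → S => replication s i :=
  measurable_pi_lambda _ fun _ => measurable_pi_apply _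

theorem measurable_compromiseObj [MeasurableSpace S] (hFm : ∀ x ∈ X, Measurable (F x))
    (hFc : ∀ z, ContinuousOn (fun x => F x z) X) (hd : ∀ s, A.decision s ∈ X)
    (hAm : ∀ x ∈ X, Measurable fun s => A.approx s x) (hdm : Measurable A.decision)
    (hsm : Measurable fun q : (Fin n → S) × (Fin n → S) => sub (A.decision q.2) q.1)
    {x : Vec p} (hx : x ∈ X) :
    Measurable fun s : Fin (m * n) → S => compromiseObj F A sub ε₂ ρ s x := by
  have hr := fun i : Fin m => measurable_replication (S := S) (n := n) i
  have hdr : ∀ i : Fin m, Measurable fun s : Fin (m * n) → S => A.decision (replication s i) :=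
    fun i => hdm.comp (hr i)
  -- The decisions are random, so joint measurability in `(x, s)` is needed; it follows from
  -- continuity in `x` and measurability in `s`.
  have hjoint : Measurable (Function.uncurry fun (x : X) (s : Fin n → S) => saaObj F s x) := by
    refine measurable_uncurry_of_continuous_of_measurable (fun s => ?_)
      fun x => measurable_saaObj (hFm x x.2)
    exact continuous_const.mul (continuous_finsetSum _ fun i _ => (hFc (s i)).domRestrict)
  have hsaa : ∀ i j : Fin m, Measurable fun s : Fin (m * n) → S =>
      saaObj F (replication s i) (A.decision (replication s j)) := fun i j =>
    hjoint.comp (((hdr j).subtype_mk (h := fun s => hd (replication s j))).prodMk (hr i))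
  have hsub : ∀ i j : Fin m, Measurable fun s : Fin (m * n) → S =>
      sub (A.decision (replication s j)) (replication s i) := fun i j =>
    hsm.comp ((hr i).prodMk (hr j))
  have haug : ∀ i : Fin m, Measurable fun s : Fin (m * n) → S => augmented F A sub ε₂ s i x := by
    intro i
    refine ((hAm x hx).comp (hr i)).max (Measurable.iSup fun j => ?_)
    exact ((hsaa i j).add ((hsub i j).inner (measurable_const.sub (hdr j)))).sub_const ε₂
  unfold compromiseObj
  fun_prop

end Measurability

/-! ### The true objective and the law of a replication -/

section TrueObjective

variable {p : ℕ} {S Ω : Type*} [MeasurableSpace Ω] {P : Measure Ω}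
  {X : Set (Vec p)} {F : Vec p → S → ℝ} {ξ : Ω → S} {M : ℝ}

theorem integrable_cost [IsProbabilityMeasure P] [MeasurableSpace S] (hξ : AEMeasurable ξ P)
    {x : Vec p} (hFm : Measurable (F x))
    (hM : ∀ z, |F x z| ≤ M) : Integrable (fun ω => F x (ξ ω)) P :=
  Integrable.of_bound (hFm.comp_aemeasurable hξ).aestronglyMeasurable M
    (Filter.Eventually.of_forall fun ω => hM (ξ ω))

theorem abs_trueObj_le [IsProbabilityMeasure P] {x : Vec p} (hM : ∀ z, |F x z| ≤ M) :
    |trueObj P F ξ x| ≤ M := by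
  have := norm_integral_le_of_norm_le_const (μ := P) (f := fun ω => F x (ξ ω)) (C := M)
    (Filter.Eventually.of_forall fun ω => hM (ξ ω))
  simpa [trueObj] using this

theorem abs_trueObj_sub_le [IsProbabilityMeasure P] [MeasurableSpace S] (hξ : AEMeasurable ξ P)
    (hFm : ∀ x ∈ X, Measurable (F x))
    (hM : ∀ x ∈ X, ∀ z, |F x z| ≤ M) {x y : Vec p} (hx : x ∈ X) (hy : y ∈ X) {c : ℝ}
    (hc : ∀ z, |F x z - F y z| ≤ c) : |trueObj P F ξ x - trueObj P F ξ y| ≤ c := by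
  have := abs_trueObj_le (P := P) (ξ := ξ) (F := fun _ z => F x z - F y z) (x := x) hc
  rwa [trueObj, integral_sub (integrable_cost hξ (hFm x hx) (hM x hx))
    (integrable_cost hξ (hFm y hy) (hM y hy))] at this

theorem convexOn_trueObj [IsProbabilityMeasure P] [MeasurableSpace S] (hξ : AEMeasurable ξ P)
    (hX : Convex ℝ X)
    (hFm : ∀ x ∈ X, Measurable (F x)) (hM : ∀ x ∈ X, ∀ z, |F x z| ≤ M)
    (hFc : ∀ z, ConvexOn ℝ X fun x => F x z) : ConvexOn ℝ X (trueObj P F ξ) := by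
  refine ⟨hX, fun x hx y hy a b ha hb hab => ?_⟩
  have hi := fun x hx => integrable_cost (F := F) hξ (hFm x hx) (hM x hx)
  simp only [trueObj, smul_eq_mul]
  rw [← integral_const_mul, ← integral_const_mul,
    ← integral_add ((hi x hx).const_mul a) ((hi y hy).const_mul b)]
  exact integral_mono (hi _ (hX hx hy ha hb hab)) (((hi x hx).const_mul a).add
    ((hi y hy).const_mul b)) fun ω => (hFc (ξ ω)).2 hx hy ha hb hab

theorem convexOn_saaObj {n : ℕ} (hX : Convex ℝ X) (hFc : ∀ z, ConvexOn ℝ X fun x => F x z)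
    (s : Fin n → S) : ConvexOn ℝ X (saaObj F s) := by
  refine ConvexOn.smul (c := 1 / (n : ℝ)) (by positivity)
    ⟨hX, fun x hx y hy a b ha hb hab => ?_⟩
  simp only [smul_eq_mul, Finset.mul_sum, ← Finset.sum_add_distrib]
  exact Finset.sum_le_sum fun i _ => (hFc (s i)).2 hx hy ha hb hab

/-- The samples of a replication are distributed according to a product measure. -/
theorem map_replication_eq_pi [MeasurableSpace S] {m n : ℕ} {ζ : Fin (m * n) → Ω → S}
    (hindep : iIndepFun ζ P)
    (hident : ∀ k, IdentDistrib (ζ k) ξ P P) (i : Fin m) :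
    P.map (fun ω => replication (fun k => ζ k ω) i) = Measure.pi fun _ : Fin n => P.map ξ := by
  have hinj : Function.Injective fun j : Fin n => finProdFinEquiv (i, j) := fun j j' h => by
    simpa using h
  have h := (hindep.precomp hinj).map_fun_eq_pi_map fun j => (hident _).aemeasurable_fst
  simp only [(hident _).map_eq] at h
  exact h

end TrueObjective

/-! ### The two bounds on the augmented functions -/

section Augmented

variable {p m n : ℕ} {S : Type*} {X : Set (Vec p)} {F : Vec p → S → ℝ}
  {A : CuttingPlaneOutput p n S} {sub : Vec p → (Fin n → S) → Vec p} {ε₁ ε₂ : ℝ}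

/-- Lowering the cuts by `ε₂` keeps each of them under the sample average, so the deterministic
estimate is free of `ε₂`. -/
theorem augmented_le (hA : A.OuterApproximation X F)
    (hsub : ∀ s s' : Fin n → S, IsEpsSubgradient X (saaObj F s) ε₂ (A.decision s')
      (sub (A.decision s') s)) (s : Fin (m * n) → S) (i : Fin m) {x : Vec p} (hx : x ∈ X) :
    augmented F A sub ε₂ s i x ≤ saaObj F (replication s i) x := by
  have : Nonempty (Fin m) := ⟨i⟩
  exact max_le (hA _ x hx) (ciSup_le fun j => hsub _ _ x hx)

theorem le_augmented (hA : A.Termination X F ε₁) (s : Fin (m * n) → S) (i : Fin m) {x : Vec p}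
    (hx : x ∈ X) : saaObj F (replication s i) (A.decision (replication s i)) - ε₁
      ≤ augmented F A sub ε₂ s i x := by
  obtain ⟨_, h1, h2⟩ := hA (replication s i)
  have := isMinOn_iff.1 h1 x hx
  exact le_trans (by linarith) (le_max_left _ _)

end Augmented

end CompromiseSP

end

/-! ### The mean and tail bounds -/

theorem theorem4p1
    {Ω : Type*} [MeasurableSpace Ω] (P : Measure Ω) [IsProbabilityMeasure P]
    {p d : ℕ} (X : Set (CompromiseSP.Vec p)) (Ξ : Set (CompromiseSP.Vec d))
    (F : CompromiseSP.Vec p → Ξ → ℝ)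
    -- the feasible set
    (hXne : X.Nonempty) (hXcompact : IsCompact X) (hXconvex : Convex ℝ X)
    (D : ℝ) (hD : 0 ≤ D) (hXcube : CompromiseSP.InCube X D)
    -- the random cost: measurable in `ξ`; Hölder, bounded and convex in `x`
    (hFmeas : ∀ x ∈ X, Measurable (F x))
    (L γ : ℝ) (hL : 0 ≤ L) (hγ0 : 0 < γ) (hγ1 : γ ≤ 1)
    (hFholder : ∀ x ∈ X, ∀ y ∈ X, ∀ z : Ξ, |F x z - F y z| ≤ L * ‖x - y‖ ^ γ)
    (M : ℝ) (hM : 0 < M) (hFbdd : ∀ x ∈ X, ∀ z : Ξ, |F x z| < M)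
    (hFconvex : ∀ z : Ξ, ConvexOn ℝ X (fun x => F x z))
    -- `m` replications with `n` samples each, all i.i.d. copies of `ξt`
    (m n : ℕ) (hm : 0 < m) (hn : 0 < n)
    (ξt : Ω → Ξ) (ξ : Fin (m * n) → Ω → Ξ)
    (hindep : iIndepFun ξ P) (hident : ∀ k, IdentDistrib (ξ k) ξt P P)
    -- the parameters
    (ε ε₁ ε₂ ρ lam : ℝ) (hε : 0 < ε) (hεε₁ : ε ≤ ε₁) (hε₂ : 0 ≤ ε₂) (hρ : 0 < ρ)
    (hlam0 : 0 < lam) (hlam1 : lam < 1 / 2)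
    -- the algorithm
    (A : CompromiseSP.CuttingPlaneOutput p n Ξ)
    (hA_outer : A.OuterApproximation X F) (hA_term : A.Termination X F ε₁)
    (hA_approx_meas : ∀ x ∈ X, Measurable (fun s => A.approx s x))
    (hA_decision_meas : Measurable A.decision)
    -- the `ε₂`-subgradients at the estimated decisions
    (sub : CompromiseSP.Vec p → (Fin n → Ξ) → CompromiseSP.Vec p)
    (hsub : ∀ s s' : Fin n → Ξ, CompromiseSP.IsEpsSubgradient X (CompromiseSP.saaObj F s) ε₂
      (A.decision s') (sub (A.decision s') s))
    (hsub_meas : Measurable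
      (fun q : (Fin n → Ξ) × (Fin n → Ξ) => sub (A.decision q.2) q.1))
    -- notation for the bounds
    (NF DX τ₁ τ₂ : ℝ) (hNF : NF = CompromiseSP.constNF p L D γ M lam)
    (hDX : DX = Metric.diam X) (hτ₁ : τ₁ = ε₁ - ε)
    (hτ₂ : τ₂ = ε₁ + ((m : ℝ) - 1) / m * ε₂ - ε)
    (Δ : Ω → ℝ) (hΔ : Δ = CompromiseSP.compromiseDist P X F ξt ξ A sub ε₂ ρ ε) :
    (Integrable Δ P ∧
      ∫ ω, Δ ω ∂P ≤ DX * NF / ε * ((8 * m - 4) / (m * (n : ℝ) ^ lam))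
        + (τ₁ + τ₂) * DX / ε + 2 * √(ε / ρ)) ∧
    (ε₁ = ε → ε₂ = 0 → ρ = n → 0 < DX → ∀ t : ℝ, 0 ≤ t →
      P.real {ω | ε ^ (3 / 2 : ℝ) / DX + (4 * m - 2) * NF / m + t
          ≤ ε * (n : ℝ) ^ lam / (2 * DX) * Δ ω}
        ≤ m * Real.exp (-((m : ℝ) ^ 2 * t ^ 2 / (2 * M ^ 2 * (2 * m - 1) ^ 2)))) := by
  open CompromiseSP in
  have hm' : (0 : ℝ) < m := by exact_mod_cast hm
  have hm1 : (1 : ℝ) ≤ m := by exact_mod_cast hm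
  have hn1 : (1 : ℝ) ≤ n := by exact_mod_cast hn
  have hn' : (0 : ℝ) < n := by linarith
  have hξt : AEMeasurable ξt P := (hident ⟨0, Nat.mul_pos hm hn⟩).aemeasurable_snd
  have hν : IsProbabilityMeasure (P.map ξt) := Measure.isProbabilityMeasure_map hξt
  have hFM : ∀ x ∈ X, ∀ z, |F x z| ≤ M := fun x hx z => (hFbdd x hx z).le
  have hFcont : ∀ z, ContinuousOn (fun x => F x z) X := fun z =>
    continuousOn_of_holder hγ0 fun x hx y hy => hFholder x hx y hy z
  set f := trueObj P F ξt with hf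
  have hfint : ∀ x ∈ X, f x = ∫ z, F x z ∂(P.map ξt) := fun x hx =>
    (integral_map hξt (hFmeas x hx).aestronglyMeasurable).symm
  have hfM : ∀ x ∈ X, |f x| ≤ M := fun x hx => abs_trueObj_le (hFM x hx)
  have hfholder : ∀ x ∈ X, ∀ y ∈ X, |f x - f y| ≤ L * ‖x - y‖ ^ γ := fun x hx y hy =>
    abs_trueObj_sub_le hξt hFmeas hFM hx hy (hFholder x hx y hy)
  have hfcont : ContinuousOn f X := continuousOn_of_holder hγ0 hfholder
  have hfconvex : ConvexOn ℝ X f := convexOn_trueObj hξt hXconvex hFmeas hFM hFconvex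
  have hdev : Measurable fun s : Fin n → Ξ => uniformDev X F f s :=
    measurable_uniformDev hXne hn hFM hfM hFmeas hFcont hfcont
  have hd : ∀ s, A.decision s ∈ X := fun s => (hA_term s).1
  have hsample : AEMeasurable (fun ω k => ξ k ω) P :=
    aemeasurable_pi_lambda _ fun k => (hident k).aemeasurable_fst
  have hrep : ∀ i, AEMeasurable (fun ω => replication (n := n) (fun k => ξ k ω) i) P := fun i =>
    (measurable_replication i).comp_aemeasurable hsample
  have hlaw := map_replication_eq_pi (n := n) hindep hident
  set δ : Fin m → Ω → ℝ := fun i ω => uniformDev X F f (replication (fun k => ξ k ω) i) with hδ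
  have hδint : ∀ i, Integrable (δ i) P := fun i =>
    Integrable.of_bound (hdev.comp_aemeasurable (hrep i)).aestronglyMeasurable (2 * M)
      (Filter.Eventually.of_forall fun ω => abs_uniformDev_le hXne hn hFM hfM _)
  have hδmean : ∀ i, ∫ ω, δ i ω ∂P
      = ∫ s : Fin n → Ξ, uniformDev X F f s ∂(Measure.pi fun _ => P.map ξt) := by
    intro i
    rw [← hlaw i, integral_map (hrep i) hdev.aestronglyMeasurable]
  have hmean : ∫ s : Fin n → Ξ, uniformDev X F f s ∂(Measure.pi fun _ => P.map ξt)
      ≤ 2 * NF / (n : ℝ) ^ lam := by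
    rw [hNF]
    exact integral_uniformDev_le hXne hD hXcube hn hL hγ0 hγ1 hlam0 hlam1 hM hFM hFmeas hFholder
      hfholder hfint hfM
  have hDX0 : 0 ≤ DX := hDX ▸ Metric.diam_nonneg
  have hΔle : ∀ ω, Δ ω ≤ DX / ε * (2 * (ε₁ - ε) + (4 * m - 2) / (m : ℝ) ^ 2 * ∑ i, δ i ω)
      + 2 * √(ε / ρ) := by
    intro ω
    rw [hΔ, hDX]
    exact pessimisticDist_epsSolSet_le hXne hXcompact hfconvex hfcont
      (fun i => convexOn_saaObj hXconvex hFconvex _) hm (fun i => hd _)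
      (fun i x hx => abs_saaObj_sub_le_uniformDev hn hFM hfM _ hx)
      (fun i x hx => augmented_le hA_outer hsub _ i hx)
      (fun i x hx => le_augmented hA_term _ i hx) hρ hε hεε₁
  have hΔint : Integrable Δ P := by
    have hmeas : Measurable fun s : Fin (m * n) → Ξ =>
        pessimisticDist (compromiseSolSet X F A sub ε₂ ρ ε s) (epsSolSet X f ε) :=
      measurable_pessimisticDist_epsSolSet hXne hXcompact
        (fun s => (convexOn_compromiseObj F A sub ε₂ ρ s hρ.le).subset (Set.subset_univ _) hXconvex)
        (fun s => (continuous_compromiseObj F A sub ε₂ ρ s).continuousOn)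
        (fun x hx => measurable_compromiseObj ε₂ ρ hFmeas hFcont hd hA_approx_meas
          hA_decision_meas hsub_meas hx) hε _
    rw [hΔ]
    refine Integrable.of_bound (hmeas.comp_aemeasurable hsample).aestronglyMeasurable
      (Metric.diam X) (Filter.Eventually.of_forall fun ω => ?_)
    refine (Real.norm_of_nonneg (pessimisticDist_nonneg _ _)).trans_le ?_
    exact pessimisticDist_le_diam hXcompact.isBounded (fun x hx => hx.1) (fun x hx => hx.1)
      (epsSolSet_nonempty hXne hXcompact hfcont hε.le)
  have hm2 : (0 : ℝ) < 4 * m - 2 := by linarith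
  have hq : 0 < (n : ℝ) ^ lam := by positivity
  refine ⟨⟨hΔint, ?_⟩, ?_⟩
  · have hsumint : Integrable (fun ω => ∑ i, δ i ω) P := integrable_finsetSum _ fun i _ => hδint i
    have hinner : Integrable (fun ω => (4 * m - 2) / (m : ℝ) ^ 2 * ∑ i, δ i ω) P :=
      hsumint.const_mul _
    have hmono := integral_mono hΔint ((((integrable_const (2 * (ε₁ - ε))).add hinner).const_mul
      (DX / ε)).add (integrable_const (2 * √(ε / ρ)))) hΔle
    refine hmono.trans ?_
    have hval : ∫ ω, (DX / ε * (2 * (ε₁ - ε) + (4 * m - 2) / (m : ℝ) ^ 2 * ∑ i, δ i ω)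
        + 2 * √(ε / ρ)) ∂P
        = DX / ε * (2 * (ε₁ - ε) + (4 * m - 2) / (m : ℝ) ^ 2 * ∑ i, ∫ ω, δ i ω ∂P)
          + 2 * √(ε / ρ) := by
      have hi : Integrable (fun ω => DX / ε * (2 * (ε₁ - ε)
          + (4 * m - 2) / (m : ℝ) ^ 2 * ∑ i, δ i ω)) P :=
        ((integrable_const _).add hinner).const_mul _
      rw [integral_add hi (integrable_const _), integral_const_mul,
        integral_add (integrable_const _) hinner,
        integral_const_mul ((4 * m - 2) / (m : ℝ) ^ 2),
        integral_finsetSum _ fun i _ => hδint i]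
      simp
    refine hval.le.trans ?_
    have hsum : ∑ i, ∫ ω, δ i ω ∂P ≤ m * (2 * NF / (n : ℝ) ^ lam) := by
      refine (Finset.sum_le_sum fun i _ => (hδmean i).le.trans hmean).trans (le_of_eq ?_)
      simp
    -- The `ε₂` term of `τ₂` is pure slack.
    have hτ : 2 * (ε₁ - ε) ≤ τ₁ + τ₂ := by
      have : 0 ≤ ((m : ℝ) - 1) / m * ε₂ :=
        mul_nonneg (div_nonneg (by linarith) hm'.le) hε₂
      linarith
    calc _ ≤ DX / ε * ((τ₁ + τ₂) + (4 * m - 2) / (m : ℝ) ^ 2 * (m * (2 * NF / (n : ℝ) ^ lam)))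
          + 2 * √(ε / ρ) := by gcongr
      _ = _ := by field_simp; ring
  · intro hε₁ hε₂0 hρn hDXpos t ht
    set E := ∫ s : Fin n → Ξ, uniformDev X F f s ∂(Measure.pi fun _ => P.map ξt)
    have h2m : (0 : ℝ) < 2 * m - 1 := by linarith
    -- Solves `n ^ lam / 2 * ((4 * m - 2) / m) * r = t`: if every deviation is below its mean plus
    -- `r`, the scaled distance stays below the threshold.
    set r := t * m / (2 * m - 1) / (n : ℝ) ^ lam with hr
    have hr0 : 0 ≤ r := by positivity
    have hsubset : {ω | ε ^ (3 / 2 : ℝ) / DX + (4 * m - 2) * NF / m + t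
        ≤ ε * (n : ℝ) ^ lam / (2 * DX) * Δ ω} ⊆ ⋃ i, {ω | r ≤ δ i ω - E} := by
      intro ω hω
      simp only [Set.mem_ofPred_eq] at hω
      simp only [Set.mem_iUnion, Set.mem_ofPred_eq]
      by_contra! hlt
      have hsum : ∑ i, δ i ω < m * (r + 2 * NF / (n : ℝ) ^ lam) := by
        have : Nonempty (Fin m) := ⟨⟨0, hm⟩⟩
        calc ∑ i, δ i ω < ∑ i : Fin m, (r + 2 * NF / (n : ℝ) ^ lam) :=
              Finset.sum_lt_sum_of_nonempty Finset.univ_nonempty fun i _ => by linarith [hlt i]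
          _ = _ := by
              rw [Finset.sum_const, Finset.card_univ, Fintype.card_fin, nsmul_eq_mul]
      -- With `ρ = n`, the scaled regularization term carries `n ^ lam / √n ≤ 1`, as `lam < 1 / 2`.
      have hreg : ε * (n : ℝ) ^ lam / (2 * DX) * (2 * √(ε / ρ)) ≤ ε ^ (3 / 2 : ℝ) / DX := by
        have hε32 : ε ^ (3 / 2 : ℝ) = ε * √ε := by
          rw [Real.sqrt_eq_rpow, show (3 / 2 : ℝ) = 1 + 1 / 2 by norm_num, Real.rpow_add hε,
            Real.rpow_one]
        have hle : (n : ℝ) ^ lam ≤ √n := by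
          rw [Real.sqrt_eq_rpow]
          exact Real.rpow_le_rpow_of_exponent_le hn1 hlam1.le
        have hsn : 0 < √(n : ℝ) := Real.sqrt_pos.2 hn'
        rw [hρn, Real.sqrt_div hε.le, hε32]
        calc ε * (n : ℝ) ^ lam / (2 * DX) * (2 * (√ε / √n))
            = ε * √ε / DX * ((n : ℝ) ^ lam / √n) := by field_simp
          _ ≤ ε * √ε / DX * 1 := by
              gcongr
              exact (div_le_one hsn).2 hle
          _ = _ := mul_one _
      have hΔω := hΔle ω
      rw [hε₁, sub_self, mul_zero, zero_add] at hΔω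
      have hbound : ε * (n : ℝ) ^ lam / (2 * DX) * Δ ω
          < ε * (n : ℝ) ^ lam / (2 * DX) * (DX / ε * ((4 * m - 2) / (m : ℝ) ^ 2
            * (m * (r + 2 * NF / (n : ℝ) ^ lam)))) + ε ^ (3 / 2 : ℝ) / DX := by
        have hpos : 0 < ε * (n : ℝ) ^ lam / (2 * DX) := by positivity
        have h1 := mul_le_mul_of_nonneg_left hΔω hpos.le
        rw [mul_add] at h1
        have h2 : DX / ε * ((4 * m - 2) / (m : ℝ) ^ 2 * ∑ i, δ i ω)
            < DX / ε * ((4 * m - 2) / (m : ℝ) ^ 2 * (m * (r + 2 * NF / (n : ℝ) ^ lam))) := by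
          gcongr
        have h3 := mul_lt_mul_of_pos_left h2 hpos
        linarith
      have hval : ε * (n : ℝ) ^ lam / (2 * DX) * (DX / ε * ((4 * m - 2) / (m : ℝ) ^ 2
            * (m * (r + 2 * NF / (n : ℝ) ^ lam)))) = t + (4 * m - 2) * NF / m := by
        rw [hr]; field_simp; ring
      linarith
    have htail : ∀ i, P.real {ω | r ≤ δ i ω - E} ≤ Real.exp (-(n * r ^ 2 / (2 * M ^ 2))) := by
      intro i
      have hset : MeasurableSet {s : Fin n → Ξ | r ≤ uniformDev X F f s - E} :=
        measurableSet_le measurable_const (hdev.sub_const E)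
      have heq : P.real {ω | r ≤ δ i ω - E} = (Measure.pi fun _ : Fin n => P.map ξt).real
          {s | r ≤ uniformDev X F f s - E} := by
        rw [← hlaw i, measureReal_def, measureReal_def,
          Measure.map_apply_of_aemeasurable (hrep i) hset]
        rfl
      rw [heq]
      exact measure_uniformDev_ge_le hXne hn hFM hfM hdev hr0
    -- McDiarmid's exponent carries an extra factor `n / n ^ (2 * lam) ≥ 1`, which is dropped.
    have hexp : (m : ℝ) ^ 2 * t ^ 2 / (2 * M ^ 2 * (2 * m - 1) ^ 2) ≤ n * r ^ 2 / (2 * M ^ 2) := by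
      have hsq : ((n : ℝ) ^ lam) ^ 2 ≤ n := by
        rw [← Real.rpow_natCast, ← Real.rpow_mul hn'.le]
        calc (n : ℝ) ^ (lam * (2 : ℕ)) ≤ (n : ℝ) ^ (1 : ℝ) :=
              Real.rpow_le_rpow_of_exponent_le hn1 (by push_cast; linarith)
          _ = n := Real.rpow_one _
      have hratio : 1 ≤ n / ((n : ℝ) ^ lam) ^ 2 := (one_le_div (by positivity)).2 hsq
      have heq : n * r ^ 2 / (2 * M ^ 2) = (m : ℝ) ^ 2 * t ^ 2 / (2 * M ^ 2 * (2 * m - 1) ^ 2)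
          * (n / ((n : ℝ) ^ lam) ^ 2) := by
        rw [hr]; field_simp
      rw [heq]
      exact le_mul_of_one_le_right (by positivity) hratio
    calc _ ≤ P.real (⋃ i, {ω | r ≤ δ i ω - E}) := measureReal_mono hsubset (measure_ne_top _ _)
      _ ≤ ∑ i, P.real {ω | r ≤ δ i ω - E} := measureReal_iUnion_fintype_le _
      _ ≤ ∑ i : Fin m, Real.exp (-((m : ℝ) ^ 2 * t ^ 2 / (2 * M ^ 2 * (2 * m - 1) ^ 2))) :=
          Finset.sum_le_sum fun i _ => (htail i).trans (Real.exp_le_exp.2 (neg_le_neg hexp))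
      _ = _ := by simp
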